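/- Let $d,t\ge 0$ and $b\ge 2$ be integers. For $m\ge t$, a $(t,m,d)$-net in base $b$ is a list of $n=b^m$ points $a_1,\dots,a_n\in[0,1]^d$ (repetitions allowed) such that every elementary interval $\prod_{j=1}^d\big[c_jb^{-\kappa_j},(c_j+1)b^{-\kappa_j}\big)$, with integers $\kappa_j\ge 0$, $0\le c_j<b^{\kappa_j}$ and $\sum_j\kappa_j=m-t$ (so of volume $b^{t-m}$), contains exactly $b^t$ of them. A scrambled $(t,m,d)$-net $y_1,\dots,y_n$ is obtained from such a net by Owen's nested uniform scrambling: if $a_{ij}=\sum_{k\ge1}a_{ijk}b^{-k}$ is the base-$b$ expansion of the $j$-th coordinate of $a_i$, then $y_{ij}=\sum_{k\ge 1}\pi_{j;\,a_{ij1}\cdots a_{ij,k-1}}(a_{ijk})\,b^{-k}$, where the permutations $\pi_{j;w}$ of $\{0,\dots,b-1\}$, one for each coordinate $j$ and each finite word $w$ of digits, are independent and uniformly distributed. Let $A$ be a finite-dimensional real inner product space with a bilinear product (for example $\mathbb R$, $\mathbb C$, or a Clifford algebra with the Euclidean norm of the coefficients). Let $g:[0,1]^d\to A$ and $k:[-1,1]^d\to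 A$ be smooth (up to the boundary), and suppose that, for some $\epsilon>0$, $f_x(y)=g(y)k(x-y)$ is in $L^{1+\epsilon}([0,1]^d)$ for every $x\in[0,1]^d$. Put $$h(x)=\int_{[0,1]^d}g(y)k(x-y)\,dy,\qquad \hat h_n(x)=\frac1n\sum_{i=1}^n g(y_i)k(x-y_i),$$ $$\sigma_x^2=\int_{[0,1]^d}\|f_x(y)-h(x)\|^2\,dy,\qquad \sigma^2(h)=\int_{[0,1]^d}\sup_{x\in[0,1]^d}\|f_x(y)-h(x)\|^2\,dy,$$ and $\|u\|_\infty=\sup_{x\in[0,1]^d}\|u(x)\|$. Then: 1. There is a constant $\Gamma<\infty$ depending only on $b,t,d$ (not on $A$, $g$, $k$, $\epsilon$ or $m$) such that for every $m\ge t$, every scrambled $(t,m,d)$-net in base $b$ and every $x\in[0,1]^d$, $$\mathbb E\,\|\hat h_n(x)-h(x)\|^2\le\Gamma\,\frac{\sigma_x^2}{n},$$ and the same holds for the maxima: $$\sup_{x\in[0,1]^d}\mathbb E\,\|\hat h_n(x)-h(x)\|^2\le\frac{\Gamma}{n}\,\sup_{x\in[0,1]^d}\sigma_x^2 .$$ 2.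 $\sigma^2(h)<\infty$, and there is a constant $\Gamma'<\infty$, which may depend on $b,t,d,A,g,k$ but not on $m$ or on the net, such that for every $m\ge t$ and every scrambled $(t,m,d)$-net in base $b$, $$\mathbb E\big[\|\hat h_n-h\|_\infty^2\big]\le\Gamma'\,\frac{\sigma^2(h)}{n}.$$ In particular, for any choice of scrambled $(t,m,d)$-nets in base $b$ for $m\ge t$, $\mathbb E\big[\|\hat h_n-h\|_\infty^2\big]=O(n^{-1})$ as $n=b^m\to\infty$. -/

import Mathlib

open MeasureTheory ProbabilityTheory Set Filter Asymptotics
open scoped ENNReal NNReal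

noncomputable section

namespace ScrambledNet

/-- The closed unit cube `[0,1]^d`. -/
def unitCube (d : ℕ) : Set (Fin d → ℝ) := Icc 0 1

/-- The elementary interval in base `b` with side lengths `b^{-κ_j}` and position `c`:
`∏_j [c_j b^{-κ_j}, (c_j + 1) b^{-κ_j})`. -/
def elementaryInterval (b : ℕ) {d : ℕ} (κ : Fin d → ℕ) (c : ∀ j, Fin (b ^ κ j)) :
    Set (Fin d → ℝ) :=
  {y | ∀ j, ((c j : ℕ) : ℝ) / (b : ℝ) ^ κ j ≤ y j ∧
    y j < (((c j : ℕ) : ℝ) + 1) / (b : ℝ) ^ κ j}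

/-- `a` is a `(t, m, d)`-net in base `b`: `b^m` points of `[0,1]^d` such that each elementary
interval in base `b` of volume `b^{t-m}` contains exactly `b^t` of them
(counted with multiplicity). -/
structure IsNet (b t m : ℕ) {d : ℕ} (a : Fin (b ^ m) → Fin d → ℝ) : Prop where
  le : t ≤ m
  mem : ∀ i, a i ∈ unitCube d
  count : ∀ κ : Fin d → ℕ, ∑ j, κ j + t = m → ∀ c : ∀ j, Fin (b ^ κ j),
    Nat.card {i // a i ∈ elementaryInterval b κ c} = b ^ t

/-- Nested scrambling of the base-`b` digits of one coordinate `a ∈ [0,1)`: the digit number `k` is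
replaced by its image under the permutation that is attached to the word of the digits of `a`
preceding it. -/
def scramble {b : ℕ} [NeZero b] (π : List (Fin b) → Equiv.Perm (Fin b)) (a : ℝ) : ℝ :=
  Real.ofDigits fun k : ℕ =>
    π (List.ofFn fun l : Fin k => Real.digits a b l) (Real.digits a b k)

/-- The random permutations used by nested uniform scrambling: one for each coordinate
`j` and each finite word of digits, mutually independent, and each uniformly distributed
on the `b!` permutations of the digits. -/
structure IsUniformScrambling {b d : ℕ} {Ω : Type*} [MeasurableSpace Ω] (P : Measure Ω)
    (π : Fin d → List (Fin b) → Ω → Equiv.Perm (Fin b)) : Prop where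
  measurable : ∀ j w σ, MeasurableSet {ω | π j w ω = σ}
  uniform : ∀ j w σ, P {ω | π j w ω = σ} = ((b.factorial : ℕ) : ℝ≥0∞)⁻¹
  indep : iIndepFun (β := fun _ => Equiv.Perm (Fin b)) (m := fun _ => ⊤)
    (fun s : Fin d × List (Fin b) => π s.1 s.2) P

/-- The random points `Y i` form a scrambled `(t, m, d)`-net in base `b`: they are obtained by
nested uniform scrambling from a `(t, m, d)`-net `a`, the same random permutations being applied
to all points of the net. -/
def IsScrambledNet (b t m : ℕ) [NeZero b] {d : ℕ} {Ω : Type*} [MeasurableSpace Ω] (P : Measure Ω)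
    (Y : Fin (b ^ m) → Ω → Fin d → ℝ) : Prop :=
  ∃ (a : Fin (b ^ m) → Fin d → ℝ) (π : Fin d → List (Fin b) → Ω → Equiv.Perm (Fin b)),
    IsNet b t m a ∧ IsUniformScrambling P π ∧
      ∀ i ω j, Y i ω j = scramble (fun w => π j w ω) (a i j)

section Convolution

variable {A : Type*} [NormedAddCommGroup A] [InnerProductSpace ℝ A] {d : ℕ}

/-- The integrand `f_x(y) = g(y) k(x - y)`, where `mul` is the product of the value space. -/
def integrand (mul : A →ₗ[ℝ] A →ₗ[ℝ] A) (g k : (Fin d → ℝ) → A) (x y : Fin d → ℝ) : A :=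
  mul (g y) (k (x - y))

/-- `h(x) = ∫_{[0,1]^d} g(y) k(x - y) dy`. -/
def target (mul : A →ₗ[ℝ] A →ₗ[ℝ] A) (g k : (Fin d → ℝ) → A) (x : Fin d → ℝ) : A :=
  ∫ y in unitCube d, integrand mul g k x y

/-- `ĥ_n(x) = (1/n) ∑_i g(y_i) k(x - y_i)`. -/
def estimator (mul : A →ₗ[ℝ] A →ₗ[ℝ] A) (g k : (Fin d → ℝ) → A) {n : ℕ}
    (y : Fin n → Fin d → ℝ) (x : Fin d → ℝ) : A :=
  (n : ℝ)⁻¹ • ∑ i, integrand mul g k x (y i)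

/-- The mean squared error at `x`: `E ‖ĥ_n(x) - h(x)‖²`. -/
def mse (mul : A →ₗ[ℝ] A →ₗ[ℝ] A) (g k : (Fin d → ℝ) → A) {n : ℕ} {Ω : Type*}
    [MeasurableSpace Ω] (P : Measure Ω) (Y : Fin n → Ω → Fin d → ℝ) (x : Fin d → ℝ) : ℝ≥0∞ :=
  ∫⁻ ω, ‖estimator mul g k (fun i => Y i ω) x - target mul g k x‖ₑ ^ 2 ∂P

/-- The variance at `x`: `σ_x² = E ‖f_x(y) - h(x)‖²` for `y` uniform on `[0,1]^d`. -/
def variance (mul : A →ₗ[ℝ] A →ₗ[ℝ] A) (g k : (Fin d → ℝ) → A) (x : Fin d → ℝ) : ℝ≥0∞ :=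
  ∫⁻ y in unitCube d, ‖integrand mul g k x y - target mul g k x‖ₑ ^ 2

/-- The expected squared sup-norm error `E ‖ĥ_n - h‖_∞²`, with the supremum over
`x ∈ [0,1]^d` inside the expectation. -/
def supMse (mul : A →ₗ[ℝ] A →ₗ[ℝ] A) (g k : (Fin d → ℝ) → A) {n : ℕ} {Ω : Type*}
    [MeasurableSpace Ω] (P : Measure Ω) (Y : Fin n → Ω → Fin d → ℝ) : ℝ≥0∞ :=
  ∫⁻ ω, (⨆ x ∈ unitCube d,
    ‖estimator mul g k (fun i => Y i ω) x - target mul g k x‖ₑ) ^ 2 ∂P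

/-- `σ²(h) = E ‖f_·(y) - h‖_∞²` for `y` uniform on `[0,1]^d`, with the supremum over
`x ∈ [0,1]^d` inside the expectation. -/
def supVariance (mul : A →ₗ[ℝ] A →ₗ[ℝ] A) (g k : (Fin d → ℝ) → A) : ℝ≥0∞ :=
  ∫⁻ y in unitCube d, (⨆ x ∈ unitCube d, ‖integrand mul g k x y - target mul g k x‖ₑ) ^ 2

end Convolution

end ScrambledNet

end

/-! The pointwise bound is Owen's variance argument and holds with `Γ = b ^ (t + d)`. Cut every
coordinate after `K` digits. The integrand becomes a function on finite tables of digits, the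
scrambling becomes a uniform choice from a finite product of permutation groups, and the function
splits into orthogonal ANOVA components indexed by sets `U` of digit positions. Under scrambling the
components of different `U` are uncorrelated, so each nonempty `U` can be treated alone. If the
depths of `U` in the coordinates add up to at most `m - t`, the net integrates the component exactly
and its sum over the net vanishes (`sum_netTable_eq_zero`). Otherwise two points contribute a
nonzero correlation only if they share all digits before each position of `U`, and at most `b ^ (t +
d)` points do so with a given one (`card_neighbours_le`). Summing over `U` gives
`sum_norm_sq_sum_scrambleTable_le`. Letting `K → ∞`, with Riemann sums on the `b`-adic grid, gives
`lintegral_enorm_sub_integral_sq_le` for every continuous integrand with values in `A`.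

For the supremum inside the expectation, the sampling error is linear in the integrand, so the
fundamental theorem of calculus in `x j` applies to it: the error at `x` is the error at `x j = 0`
plus an integral over `s` of the error for the kernel `∂_j k` at `x j = s`. Extending that integral
to `[0,1]` after taking norms removes the dependence on `x j`. Doing this for every coordinate
yields a random `majorant` of the error that no longer involves `x`
(`enorm_samplingError_le_majorant`). It is a finite sum of averages of pointwise errors, so its
second moment is `O(1/n)` by the pointwise bound and Tonelli. As `Γ'` may depend on `g` and `k`, the
factor `σ²(h)` is then inserted by division, the case `σ²(h) = 0` being one of zero error. -/

noncomputable section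

namespace ScrambledNet

set_option linter.unusedSectionVars false

/-! ### Finite ANOVA decomposition of functions of digits. -/

section Anova

variable {ι : Type*} [Fintype ι] [DecidableEq ι] {b : ℕ}
  {A : Type*} [NormedAddCommGroup A] [InnerProductSpace ℝ A]

/-- The component of the finite ANOVA decomposition of `f` that belongs to the set `U` of
digit positions. -/
def anovaComponent (f : (ι → Fin b) → A) (U : Finset ι) (x : ι → Fin b) : A :=
  ((b : ℝ) ^ Fintype.card ι)⁻¹ •
    ∑ y, (∏ p ∈ U, ((if x p = y p then (b : ℝ) else 0) - 1)) • f y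

lemma dependsOn_anovaComponent (f : (ι → Fin b) → A) (U : Finset ι) :
    DependsOn (anovaComponent f U) U := by
  intro x x' h
  unfold anovaComponent
  congr 1
  refine Finset.sum_congr rfl fun y _ => ?_
  congr 1
  exact Finset.prod_congr rfl fun p hp => by rw [h p hp]

/-- Summing the products over all `U` expands `∏ p, (1 + (b·1[x p = y p] - 1))`, which is `b ^ card
ι` if `x = y` and `0` otherwise. -/
lemma sum_anovaComponent [NeZero b] (f : (ι → Fin b) → A) (x : ι → Fin b) :
    ∑ U, anovaComponent f U x = f x := by
  have hb : (b : ℝ) ^ Fintype.card ι ≠ 0 := pow_ne_zero _ (Nat.cast_ne_zero.2 (NeZero.ne b))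
  simp only [anovaComponent]
  rw [← Finset.smul_sum, Finset.sum_comm]
  simp only [← Finset.sum_smul]
  have key : ∀ y : ι → Fin b, ∑ U : Finset ι, ∏ p ∈ U, ((if x p = y p then (b : ℝ) else 0) - 1)
      = if x = y then (b : ℝ) ^ Fintype.card ι else 0 := by
    intro y
    rw [← Finset.powerset_univ, ← Finset.prod_one_add]
    simp only [add_sub_cancel]
    split_ifs with h
    · simp [h]
    · obtain ⟨p, hp⟩ := Function.ne_iff.1 h
      exact Finset.prod_eq_zero (Finset.mem_univ p) (if_neg hp)
  simp only [key, ite_smul, zero_smul, Finset.sum_ite_eq, Finset.mem_univ, if_true]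
  rw [smul_smul, inv_mul_cancel₀ hb, one_smul]

lemma anovaComponent_empty (f : (ι → Fin b) → A) (x : ι → Fin b) :
    anovaComponent f ∅ x = ((b : ℝ) ^ Fintype.card ι)⁻¹ • ∑ y, f y := by
  simp [anovaComponent]

lemma sum_anovaComponent_update (f : (ι → Fin b) → A) {U : Finset ι} {p : ι} (hp : p ∈ U)
    (x : ι → Fin b) : ∑ c, anovaComponent f U (Function.update x p c) = 0 := by
  simp only [anovaComponent]
  rw [← Finset.smul_sum, Finset.sum_comm]
  simp only [← Finset.sum_smul]
  rw [Finset.sum_eq_zero, smul_zero]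
  intro y _
  rw [show ∑ c : Fin b, ∏ q ∈ U, ((if Function.update x p c q = y q then (b : ℝ) else 0) - 1)
      = 0 from ?_, zero_smul]
  have h : ∀ c : Fin b, ∏ q ∈ U, ((if Function.update x p c q = y q then (b : ℝ) else 0) - 1)
      = ((if c = y p then (b : ℝ) else 0) - 1) *
        ∏ q ∈ U.erase p, ((if x q = y q then (b : ℝ) else 0) - 1) := by
    intro c
    rw [← Finset.mul_prod_erase U _ hp, Function.update_self]
    congr 1
    refine Finset.prod_congr rfl fun q hq => ?_
    rw [Function.update_of_ne (Finset.ne_of_mem_erase hq)]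
  simp only [h, ← Finset.sum_mul]
  simp

/-- Averaging over the rotations of the digit at a position of `U`. -/
lemma sum_anovaComponent_add_single [NeZero b] (f : (ι → Fin b) → A) {U : Finset ι} {p : ι}
    (hp : p ∈ U) (x : ι → Fin b) : ∑ c, anovaComponent f U (x + Pi.single p c) = 0 := by
  rw [← sum_anovaComponent_update f hp x]
  refine Fintype.sum_equiv (Equiv.addLeft (x p)) _ _ fun c => ?_
  congr 1
  ext1 q
  by_cases h : q = p
  · subst h; simp
  · simp [h]

lemma sum_anovaComponent_eq_zero [NeZero b] (f : (ι → Fin b) → A) {U : Finset ι}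
    (hU : U.Nonempty) : ∑ x, anovaComponent f U x = 0 := by
  obtain ⟨p, hp⟩ := hU
  have hb : (b : ℝ) ≠ 0 := Nat.cast_ne_zero.2 (NeZero.ne b)
  have hs : ∑ x : ι → Fin b, ∑ c : Fin b, anovaComponent f U (x + Pi.single p c) = 0 :=
    Finset.sum_eq_zero fun x _ => sum_anovaComponent_add_single f hp x
  have hc : ∀ c : Fin b, ∑ x : ι → Fin b, anovaComponent f U (x + Pi.single p c)
      = ∑ x, anovaComponent f U x :=
    fun c => by
      rw [← Equiv.sum_comp (Equiv.addRight (Pi.single p c : ι → Fin b)) (anovaComponent f U)]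
      simp only [Equiv.coe_addRight]
  have h : (b : ℝ) • ∑ x, anovaComponent f U x = 0 := by
    rw [← hs, Finset.sum_comm, Finset.sum_congr rfl fun c _ => hc c, Finset.sum_const,
      Finset.card_univ, Fintype.card_fin, Nat.cast_smul_eq_nsmul]
  exact (smul_eq_zero.1 h).resolve_left hb

/-- Rotating a digit at a position in one set but not in the other leaves one factor fixed and
averages the other to zero. -/
lemma inner_anovaComponent_sum_eq_zero [NeZero b] (f : (ι → Fin b) → A) {U V : Finset ι}
    (h : U ≠ V) :
    ∑ x, inner ℝ (anovaComponent f U x) (anovaComponent f V x) = 0 := by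
  wlog hUV : ∃ p ∈ U, p ∉ V generalizing U V
  · rw [← this h.symm]
    · simp only [real_inner_comm]
    · by_contra! hc
      push Not at hUV
      exact h (Finset.Subset.antisymm hUV hc)
  obtain ⟨p, hpU, hpV⟩ := hUV
  have hshift : ∀ c : Fin b, ∑ x, inner ℝ (anovaComponent f U x) (anovaComponent f V x)
      = ∑ x, inner ℝ (anovaComponent f U (x + Pi.single p c)) (anovaComponent f V x) := by
    intro c
    rw [← Equiv.sum_comp (Equiv.addRight (Pi.single p c : ι → Fin b))]
    refine Finset.sum_congr rfl fun x _ => ?_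
    congr 1
    refine dependsOn_anovaComponent f V fun q hq => ?_
    have : q ≠ p := fun hqp => hpV (hqp ▸ hq)
    simp [this]
  have hb : (b : ℝ) ≠ 0 := Nat.cast_ne_zero.2 (NeZero.ne b)
  have hsum : ∑ c : Fin b, ∑ x, inner ℝ (anovaComponent f U (x + Pi.single p c))
      (anovaComponent f V x) = 0 := by
    rw [Finset.sum_comm]
    refine Finset.sum_eq_zero fun x _ => ?_
    rw [← sum_inner, sum_anovaComponent_add_single f hpU, inner_zero_left]
  rw [← Finset.sum_congr rfl fun c _ => hshift c] at hsum
  simpa [hb] using hsum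

lemma sum_norm_sq_anovaComponent [NeZero b] (f : (ι → Fin b) → A) :
    ∑ U, ∑ x, ‖anovaComponent f U x‖ ^ 2 = ∑ x, ‖f x‖ ^ 2 := by
  have h : ∀ x, ‖f x‖ ^ 2
      = ∑ U, ∑ V, inner ℝ (anovaComponent f U x) (anovaComponent f V x) := by
    intro x
    rw [← real_inner_self_eq_norm_sq]
    conv_lhs => rw [← sum_anovaComponent f x]
    rw [sum_inner]
    simp only [inner_sum]
  simp only [h]
  conv_rhs => rw [Finset.sum_comm]
  refine Finset.sum_congr rfl fun U _ => ?_
  rw [Finset.sum_comm, Finset.sum_eq_single U]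
  · simp only [real_inner_self_eq_norm_sq]
  · exact fun V _ hV => inner_anovaComponent_sum_eq_zero f hV.symm
  · simp

end Anova

/-! ### Scrambling of finite tables of digits and the variance bound for them. -/

section FiniteScrambling

variable {b d K : ℕ}

/-- A coordinate together with a word of fewer than `K` digits. -/
abbrev Node (b d K : ℕ) : Type := Fin d × (Σ k : Fin K, (Fin k → Fin b))

/-- The word of digits that precedes the position `p` in the table `x`. -/
def node (x : Fin d × Fin K → Fin b) (p : Fin d × Fin K) : Node b d K :=
  (p.1, ⟨p.2, fun l => x (p.1, ⟨l, l.2.trans p.2.2⟩)⟩)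

/-- Nested scrambling of the first `K` digits of all the coordinates. -/
def scrambleTable (π : Node b d K → Equiv.Perm (Fin b)) (x : Fin d × Fin K → Fin b) :
    Fin d × Fin K → Fin b :=
  fun p => π (node x p) (x p)

lemma node_eq_iff {x y : Fin d × Fin K → Fin b} {p : Fin d × Fin K} :
    node x p = node y p ↔ ∀ k : Fin K, k < p.2 → x (p.1, k) = y (p.1, k) := by
  simp only [node, Prod.mk.injEq, Sigma.mk.injEq, heq_eq_eq, true_and, funext_iff]
  exact ⟨fun h k hk => h ⟨k, hk⟩, fun h l => h ⟨l, l.2.trans p.2.2⟩ l.2⟩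

lemma eq_of_node_eq_node {x y : Fin d × Fin K → Fin b} {p q : Fin d × Fin K}
    (h : node x p = node y q) : p = q := by
  have h1 := congrArg Prod.fst h
  have h2 := congrArg (fun s : Node b d K => s.2.1) h
  exact Prod.ext h1 h2

/-- The digits can be recovered from left to right: once those before a position are known, so is
the permutation used there. -/
lemma scrambleTable_injective (π : Node b d K → Equiv.Perm (Fin b)) :
    Function.Injective (scrambleTable π) := by
  intro x y hxy
  ext1 ⟨j, k⟩
  obtain ⟨k, hk⟩ := k
  induction k using Nat.strong_induction_on with
  | _ k ih =>
    have h := congrFun hxy (j, ⟨k, hk⟩)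
    have hn : node x (j, ⟨k, hk⟩) = node y (j, ⟨k, hk⟩) :=
      node_eq_iff.2 fun l hl => ih l hl l.2
    simp only [scrambleTable, hn] at h
    exact (π _).injective h

/-- A scrambled digit depends only on the digits of its coordinate up to its own position. Hence
scrambling respects elementary cells, and the exactness of a net survives it. -/
lemma dependsOn_comp_scrambleTable {β : Type*} {F : (Fin d × Fin K → Fin b) → β} {κ : Fin d → ℕ}
    (hF : DependsOn F {p : Fin d × Fin K | (p.2 : ℕ) < κ p.1})
    (π : Node b d K → Equiv.Perm (Fin b)) :
    DependsOn (fun x => F (scrambleTable π x)) {p : Fin d × Fin K | (p.2 : ℕ) < κ p.1} := by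
  intro x y hxy
  refine hF fun p hp => ?_
  have hn : node x p = node y p :=
    node_eq_iff.2 fun k hk => hxy (p.1, k) (lt_trans (Fin.lt_def.1 hk) hp)
  simp only [scrambleTable, hn, hxy p hp]

variable [NeZero b]

lemma sum_rotate {M : Type*} [AddCommMonoid M] (y : Node b d K → Fin b)
    (Φ : (Node b d K → Equiv.Perm (Fin b)) → M) :
    ∑ π : Node b d K → Equiv.Perm (Fin b), Φ (fun s => Equiv.addRight (y s) * π s) = ∑ π, Φ π :=
  Equiv.sum_comp (Equiv.mulLeft fun s => Equiv.addRight (y s)) Φ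

lemma scrambleTable_rotate (y : Node b d K → Fin b) (π : Node b d K → Equiv.Perm (Fin b))
    (x : Fin d × Fin K → Fin b) :
    scrambleTable (fun s => Equiv.addRight (y s) * π s) x
      = scrambleTable π x + fun p => y (node x p) := by
  ext1 p
  simp [scrambleTable]

/-- A scrambled table is uniformly distributed. -/
lemma card_mul_sum_scrambleTable (Φ : (Fin d × Fin K → Fin b) → ℝ) (x : Fin d × Fin K → Fin b) :
    (Fintype.card (Fin d × Fin K → Fin b) : ℝ) * ∑ π, Φ (scrambleTable π x)
      = Fintype.card (Node b d K → Equiv.Perm (Fin b)) * ∑ z, Φ z := by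
  have h : ∀ y : Fin d × Fin K → Fin b,
      ∑ π, Φ (scrambleTable π x) = ∑ π, Φ (scrambleTable π x + y) := by
    intro y
    -- The rotation depends only on the position of a node and not on its word, so it translates the
    -- whole scrambled table by `y`.
    rw [← sum_rotate fun s => y (s.1, s.2.1)]
    simp only [scrambleTable_rotate]
    rfl
  have h2 : ∑ y : Fin d × Fin K → Fin b, ∑ π, Φ (scrambleTable π x)
      = ∑ π : Node b d K → Equiv.Perm (Fin b), ∑ z, Φ z := by
    rw [Finset.sum_congr rfl fun y _ => h y, Finset.sum_comm]
    exact Finset.sum_congr rfl fun π _ => Equiv.sum_comp (Equiv.addLeft (scrambleTable π x)) Φ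
  simpa using h2

variable {A : Type*} [NormedAddCommGroup A] [InnerProductSpace ℝ A]

/-- Randomness at the single node `node x p` suffices: it averages the first factor to zero, while
the second factor either ignores position `p` or uses another permutation there. -/
lemma sum_inner_anovaComponent_scrambleTable (f : (Fin d × Fin K → Fin b) → A)
    {U V : Finset (Fin d × Fin K)} {p : Fin d × Fin K} (hU : p ∈ U)
    {x x' : Fin d × Fin K → Fin b} (h : p ∉ V ∨ node x p ≠ node x' p) :
    ∑ π, inner ℝ (anovaComponent f U (scrambleTable π x))
      (anovaComponent f V (scrambleTable π x')) = 0 := by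
  have hrot : ∀ c : Fin b, ∑ π, inner ℝ (anovaComponent f U (scrambleTable π x))
      (anovaComponent f V (scrambleTable π x'))
      = ∑ π, inner ℝ (anovaComponent f U (scrambleTable π x + Pi.single p c))
        (anovaComponent f V (scrambleTable π x')) := by
    intro c
    -- Only the permutation at `node x p` is rotated. A node determines its position, so in the
    -- table of `x` the digit at `p` alone changes.
    rw [← sum_rotate fun s => if s = node x p then c else 0]
    refine Finset.sum_congr rfl fun π _ => ?_
    simp only [scrambleTable_rotate]
    congr 1
    · congr 2
      ext1 q
      by_cases hq : q = p
      · subst hq; simp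
      · rw [if_neg fun hn => hq (eq_of_node_eq_node hn), Pi.single_eq_of_ne hq]
    · refine dependsOn_anovaComponent f V fun q hq => ?_
      rw [Pi.add_apply, if_neg, add_zero]
      intro hn
      have hqp := eq_of_node_eq_node hn
      subst hqp
      exact h.elim (fun h => h hq) (fun h => h hn.symm)
  have hb : (b : ℝ) ≠ 0 := Nat.cast_ne_zero.2 (NeZero.ne b)
  have hsum : ∑ c : Fin b, ∑ π, inner ℝ (anovaComponent f U (scrambleTable π x + Pi.single p c))
      (anovaComponent f V (scrambleTable π x')) = 0 := by
    rw [Finset.sum_comm]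
    refine Finset.sum_eq_zero fun π _ => ?_
    rw [← sum_inner, sum_anovaComponent_add_single f hU, inner_zero_left]
  rw [← Finset.sum_congr rfl fun c _ => hrot c] at hsum
  simpa [hb] using hsum

variable {I : Type*} [Fintype I]

/-- The tables `a i` of digits form a net: each elementary cell contains `b ^ t` of them. -/
def IsNetTable (t m : ℕ) (a : I → Fin d × Fin K → Fin b) : Prop :=
  ∀ κ : Fin d → ℕ, ∑ j, κ j + t = m → ∀ x : Fin d × Fin K → Fin b,
    Nat.card {i // ∀ p : Fin d × Fin K, (p.2 : ℕ) < κ p.1 → a i p = x p} = b ^ t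

/-- The number of leading digits of each coordinate on which `U` bears. -/
def depth (U : Finset (Fin d × Fin K)) (j : Fin d) : ℕ :=
  (U.filter fun p => p.1 = j).sup fun p => (p.2 : ℕ) + 1

lemma lt_depth {U : Finset (Fin d × Fin K)} {p : Fin d × Fin K} (hp : p ∈ U) :
    (p.2 : ℕ) < depth U p.1 := by
  have : (p.2 : ℕ) + 1 ≤ depth U p.1 :=
    Finset.le_sup (f := fun p : Fin d × Fin K => (p.2 : ℕ) + 1) (by simp [hp])
  exact this

lemma exists_mem_of_lt_depth {U : Finset (Fin d × Fin K)} {j : Fin d} {k : ℕ}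
    (h : k < depth U j) : ∃ p ∈ U, p.1 = j ∧ k ≤ p.2 := by
  obtain ⟨p, hp, hk⟩ := (Finset.lt_sup_iff).1 h
  simp only [Finset.mem_filter] at hp
  exact ⟨p, hp.1, hp.2, Nat.lt_succ_iff.1 hk⟩

lemma exists_le_sum_eq {d : ℕ} (κ : Fin d → ℕ) {N : ℕ} (h : N ≤ ∑ j, κ j) :
    ∃ κ' ≤ κ, ∑ j, κ' j = N := by
  induction hn : ∑ j, κ j - N generalizing κ with
  | zero => exact ⟨κ, le_rfl, by omega⟩
  | succ n ih =>
    have hpos : ∑ j, κ j ≠ 0 := by omega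
    obtain ⟨j, -, hj⟩ := Finset.exists_ne_zero_of_sum_ne_zero hpos
    have hs : ∑ i, Function.update κ j (κ j - 1) i + 1 = ∑ i, κ i := by
      rw [← Finset.add_sum_erase _ _ (Finset.mem_univ j),
        ← Finset.add_sum_erase _ κ (Finset.mem_univ j), Function.update_self,
        Finset.sum_congr rfl fun i hi =>
          Function.update_of_ne (Finset.ne_of_mem_erase hi) (κ j - 1) κ, add_right_comm]
      congr 1
      omega
    obtain ⟨κ', h1, h2⟩ := ih (Function.update κ j (κ j - 1)) (by omega) (by omega)
    refine ⟨κ', h1.trans ?_, h2⟩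
    rw [update_le_self_iff]
    omega

/-- The coordinate `j` absorbs the surplus; without any coordinate only `N = 0` would be possible.
-/
lemma exists_ge_sum_eq {d : ℕ} (κ : Fin d → ℕ) (j : Fin d) {N : ℕ} (h : ∑ j, κ j ≤ N) :
    ∃ κ', κ ≤ κ' ∧ ∑ j, κ' j = N := by
  refine ⟨κ + Pi.single j (N - ∑ j, κ j), by simp, ?_⟩
  simp only [Pi.add_apply, Finset.sum_add_distrib, Finset.sum_pi_single', Finset.mem_univ, if_true]
  omega

/-- Choose `κ ≤ depth U` of total `m - t`. Sharing the nodes of `U` forces agreement on the first `κ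
j - 1` digits of coordinate `j`, that is, on all but the last digit that defines the cell. The `d`
remaining digits give `b ^ d` classes, each inside one cell with `b ^ t` points. -/
lemma card_neighbours_le {t m : ℕ} {a : I → Fin d × Fin K → Fin b} (ha : IsNetTable t m a)
    (htm : t ≤ m) {U : Finset (Fin d × Fin K)} (hU : m ≤ ∑ j, depth U j + t) (i : I) :
    Nat.card {i' // ∀ p ∈ U, node (a i) p = node (a i') p} ≤ b ^ (t + d) := by
  classical
  obtain ⟨κ, hκ, hsum⟩ := exists_le_sum_eq (depth U) (N := m - t) (by omega)
  have hagree : ∀ i', (∀ p ∈ U, node (a i) p = node (a i') p) →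
      ∀ q : Fin d × Fin K, (q.2 : ℕ) + 1 < κ q.1 → a i q = a i' q := by
    intro i' h q hq
    obtain ⟨p, hp, hpj, hk⟩ := exists_mem_of_lt_depth (hq.trans_le (hκ q.1))
    have := node_eq_iff.1 (h p hp) q.2 (Fin.lt_def.2 hk)
    rwa [hpj] at this
  -- The last digit defining the cell in each coordinate. If `κ j = 0`, truncated subtraction
  -- selects digit `0`, which only refines the classes.
  let φ : I → Fin d → Fin b := fun i' j =>
    if h : κ j - 1 < K then a i' (j, ⟨κ j - 1, h⟩) else 0
  rw [Nat.card_eq_fintype_card, Fintype.card_subtype]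
  have := Finset.card_le_mul_card_image_of_maps_to
    (s := Finset.univ.filter fun i' => ∀ p ∈ U, node (a i) p = node (a i') p)
    (t := Finset.univ) (f := φ) (fun _ _ => Finset.mem_univ _) (b ^ t) ?_
  · simpa [pow_add] using this
  intro y _
  rcases Finset.eq_empty_or_nonempty (Finset.filter (fun i' => φ i' = y)
    (Finset.univ.filter fun i' => ∀ p ∈ U, node (a i) p = node (a i') p)) with h0 | ⟨i₀, hi₀⟩
  · rw [h0]; simp
  have hc := ha κ (by omega) (a i₀)
  rw [Nat.card_eq_fintype_card, Fintype.card_subtype] at hc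
  rw [← hc]
  refine Finset.card_le_card fun i' hi' => ?_
  simp only [Finset.mem_filter, Finset.mem_univ, true_and] at hi' hi₀ ⊢
  intro p hp
  rcases Nat.lt_or_ge ((p.2 : ℕ) + 1) (κ p.1) with h1 | h1
  · rw [← hagree i' hi'.1 p h1, ← hagree i₀ hi₀.1 p h1]
  · have h2 : κ p.1 - 1 = p.2 := by omega
    have h3 : κ p.1 - 1 < K := h2 ▸ p.2.2
    have h4 : (⟨κ p.1 - 1, h3⟩ : Fin K) = p.2 := Fin.ext h2
    have h5 := congrFun (hi'.2.trans hi₀.2.symm) p.1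
    simpa only [φ, dif_pos h3, h4] using h5

/-- Double counting of pairs (net point, table) in the same cell: each cell contains `N` tables and
`b ^ t` net points, so the sum over the net is a multiple of the sum over all tables. -/
lemma sum_netTable_eq_zero {t m : ℕ} {a : I → Fin d × Fin K → Fin b} (ha : IsNetTable t m a)
    {κ : Fin d → ℕ} (hκ : ∑ j, κ j + t = m) {F : (Fin d × Fin K → Fin b) → A}
    (hF : DependsOn F {p : Fin d × Fin K | (p.2 : ℕ) < κ p.1}) (h0 : ∑ x, F x = 0) :
    ∑ i, F (a i) = 0 := by
  classical
  let N : ℕ := ∏ p : Fin d × Fin K, if (p.2 : ℕ) < κ p.1 then 1 else b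
  have hN : ∀ y : Fin d × Fin K → Fin b, (Finset.univ.filter fun x : Fin d × Fin K → Fin b =>
      ∀ p : Fin d × Fin K, (p.2 : ℕ) < κ p.1 → y p = x p).card = N := by
    intro y
    have : (Finset.univ.filter fun x : Fin d × Fin K → Fin b =>
        ∀ p : Fin d × Fin K, (p.2 : ℕ) < κ p.1 → y p = x p)
        = Fintype.piFinset fun p : Fin d × Fin K =>
          if (p.2 : ℕ) < κ p.1 then {y p} else Finset.univ := by
      ext x
      simp only [Finset.mem_filter, Finset.mem_univ, true_and, Fintype.mem_piFinset]
      refine forall_congr' fun p => ?_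
      split_ifs with h <;> simp [h, eq_comm]
    rw [this, Fintype.card_piFinset]
    refine Finset.prod_congr rfl fun p _ => ?_
    split_ifs <;> simp
  have hN0 : (N : ℝ) ≠ 0 := by
    refine Nat.cast_ne_zero.2 (Finset.prod_ne_zero_iff.2 fun p _ => ?_)
    split_ifs
    · exact one_ne_zero
    · exact NeZero.ne b
  have h1 : ∑ i, ∑ x : Fin d × Fin K → Fin b,
      (if ∀ p : Fin d × Fin K, (p.2 : ℕ) < κ p.1 → a i p = x p then F (a i) else 0)
      = (N : ℝ) • ∑ i, F (a i) := by
    rw [Finset.smul_sum]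
    refine Finset.sum_congr rfl fun i _ => ?_
    rw [← Finset.sum_filter, Finset.sum_const, hN, Nat.cast_smul_eq_nsmul]
  have h2 : ∑ i, ∑ x : Fin d × Fin K → Fin b,
      (if ∀ p : Fin d × Fin K, (p.2 : ℕ) < κ p.1 → a i p = x p then F (a i) else 0)
      = ((b ^ t : ℕ) : ℝ) • ∑ x, F x := by
    rw [Finset.sum_comm, Finset.smul_sum]
    refine Finset.sum_congr rfl fun x _ => ?_
    have hc := ha κ hκ x
    rw [Nat.card_eq_fintype_card, Fintype.card_subtype] at hc
    rw [← Finset.sum_filter, Nat.cast_smul_eq_nsmul, ← hc, ← Finset.sum_const]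
    refine Finset.sum_congr rfl fun i hi => hF fun p hp => ?_
    exact (Finset.mem_filter.1 hi).2 p hp
  rw [h1, h0, smul_zero] at h2
  exact (smul_eq_zero.1 h2).resolve_left hN0

/-- For shallow `U` the left side is zero by exactness. For deep `U` only neighbouring pairs survive
in the expanded square, and each is bounded by the second moment of the component, since every
scrambled table is uniform. -/
lemma sum_norm_sq_sum_anovaComponent_le {t m : ℕ} {a : I → Fin d × Fin K → Fin b}
    (ha : IsNetTable t m a) (htm : t ≤ m) (f : (Fin d × Fin K → Fin b) → A)
    {U : Finset (Fin d × Fin K)} (hU : U.Nonempty) :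
    (Fintype.card (Fin d × Fin K → Fin b) : ℝ) *
        ∑ π, ‖∑ i, anovaComponent f U (scrambleTable π (a i))‖ ^ 2
      ≤ (b : ℝ) ^ (t + d) * Fintype.card I * Fintype.card (Node b d K → Equiv.Perm (Fin b)) *
        ∑ x, ‖anovaComponent f U x‖ ^ 2 := by
  classical
  obtain ⟨p₀, hp₀⟩ := hU
  rcases le_total (∑ j, depth U j + t) m with hle | hge
  · obtain ⟨κ, hκ, hsum⟩ := exists_ge_sum_eq (depth U) p₀.1 (N := m - t) (by omega)
    have hz : ∀ π : Node b d K → Equiv.Perm (Fin b),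
        ∑ i, anovaComponent f U (scrambleTable π (a i)) = 0 := by
      intro π
      refine sum_netTable_eq_zero ha (κ := κ) (by omega)
        (F := fun x => anovaComponent f U (scrambleTable π x)) ?_ ?_
      · refine dependsOn_comp_scrambleTable ((dependsOn_anovaComponent f U).mono ?_) π
        exact fun p hp => (lt_depth hp).trans_le (hκ p.1)
      · have hbij : Function.Bijective (scrambleTable π) :=
          Finite.injective_iff_bijective.1 (scrambleTable_injective π)
        rw [hbij.sum_comp (anovaComponent f U)]
        exact sum_anovaComponent_eq_zero f ⟨p₀, hp₀⟩
    simp only [hz, norm_zero]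
    rw [Finset.sum_eq_zero (by simp), mul_zero]
    positivity
  · set X : ℝ := (Fintype.card (Fin d × Fin K → Fin b) : ℝ)
    have hX0 : 0 ≤ X := by positivity
    set G : ℝ := (Fintype.card (Node b d K → Equiv.Perm (Fin b)) : ℝ)
    set S : ℝ := ∑ x, ‖anovaComponent f U x‖ ^ 2
    have hone : ∀ i, X * ∑ π, ‖anovaComponent f U (scrambleTable π (a i))‖ ^ 2 = G * S :=
      fun i => card_mul_sum_scrambleTable (fun z => ‖anovaComponent f U z‖ ^ 2) (a i)
    have hpair : ∀ i i', X * ∑ π, inner ℝ (anovaComponent f U (scrambleTable π (a i)))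
        (anovaComponent f U (scrambleTable π (a i')))
        ≤ if ∀ p ∈ U, node (a i) p = node (a i') p then G * S else 0 := by
      intro i i'
      split_ifs with h
      · have : ∑ π, inner ℝ (anovaComponent f U (scrambleTable π (a i)))
            (anovaComponent f U (scrambleTable π (a i')))
            ≤ ∑ π, (‖anovaComponent f U (scrambleTable π (a i))‖ ^ 2
              + ‖anovaComponent f U (scrambleTable π (a i'))‖ ^ 2) / 2 := by
          refine Finset.sum_le_sum fun π _ => ?_
          have h1 := real_inner_le_norm (anovaComponent f U (scrambleTable π (a i)))
            (anovaComponent f U (scrambleTable π (a i')))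
          nlinarith [sq_nonneg (‖anovaComponent f U (scrambleTable π (a i))‖ -
            ‖anovaComponent f U (scrambleTable π (a i'))‖)]
        refine (mul_le_mul_of_nonneg_left this hX0).trans (le_of_eq ?_)
        rw [← Finset.sum_div, Finset.sum_add_distrib, ← mul_div_assoc, mul_add, hone, hone]
        ring
      · push Not at h
        obtain ⟨p, hp, hne⟩ := h
        rw [sum_inner_anovaComponent_scrambleTable f hp (Or.inr hne), mul_zero]
    have hexp : X * ∑ π, ‖∑ i, anovaComponent f U (scrambleTable π (a i))‖ ^ 2
        = ∑ i, ∑ i', X * ∑ π, inner ℝ (anovaComponent f U (scrambleTable π (a i)))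
          (anovaComponent f U (scrambleTable π (a i'))) := by
      simp only [← Finset.mul_sum]
      congr 1
      simp only [← real_inner_self_eq_norm_sq, sum_inner, inner_sum]
      rw [Finset.sum_comm]
      refine Finset.sum_congr rfl fun i _ => ?_
      rw [Finset.sum_comm]
      exact Finset.sum_congr rfl fun i' _ => Finset.sum_congr rfl fun π _ => real_inner_comm _ _
    rw [hexp]
    have hGS : 0 ≤ G * S := by positivity
    calc _ ≤ ∑ i, ∑ i', if ∀ p ∈ U, node (a i) p = node (a i') p then G * S else 0 :=
          Finset.sum_le_sum fun i _ => Finset.sum_le_sum fun i' _ => hpair i i'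
      _ ≤ ∑ _i : I, (b : ℝ) ^ (t + d) * (G * S) := by
          refine Finset.sum_le_sum fun i _ => ?_
          rw [← Finset.sum_filter, Finset.sum_const, nsmul_eq_mul]
          refine mul_le_mul_of_nonneg_right ?_ hGS
          have := card_neighbours_le ha htm hge i
          rw [Nat.card_eq_fintype_card, Fintype.card_subtype] at this
          exact_mod_cast this
      _ = _ := by
          rw [Finset.sum_const, nsmul_eq_mul, Finset.card_univ]
          ring

/-- The variance bound for functions of finitely many digits. -/
theorem sum_norm_sq_sum_scrambleTable_le {t m : ℕ} {a : I → Fin d × Fin K → Fin b}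
    (ha : IsNetTable t m a) (htm : t ≤ m) (f : (Fin d × Fin K → Fin b) → A) :
    (Fintype.card (Fin d × Fin K → Fin b) : ℝ) *
        ∑ π, ‖∑ i, (f (scrambleTable π (a i)) -
          ((b : ℝ) ^ Fintype.card (Fin d × Fin K))⁻¹ • ∑ y, f y)‖ ^ 2
      ≤ (b : ℝ) ^ (t + d) * Fintype.card I * Fintype.card (Node b d K → Equiv.Perm (Fin b)) *
        ∑ x, ‖f x‖ ^ 2 := by
  classical
  let Y : Finset (Fin d × Fin K) → (Node b d K → Equiv.Perm (Fin b)) → A :=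
    fun U π => ∑ i, anovaComponent f U (scrambleTable π (a i))
  have hY : ∀ π : Node b d K → Equiv.Perm (Fin b), ∑ i, (f (scrambleTable π (a i)) -
      ((b : ℝ) ^ Fintype.card (Fin d × Fin K))⁻¹ • ∑ y, f y)
      = ∑ U ∈ Finset.univ.erase ∅, Y U π := by
    -- The component of `∅` is the mean, so subtracting the mean removes exactly this component.
    intro π
    simp only [Y]
    rw [Finset.sum_comm]
    refine Finset.sum_congr rfl fun i _ => ?_
    rw [← sum_anovaComponent f (scrambleTable π (a i)),
      ← Finset.add_sum_erase _ _ (Finset.mem_univ ∅), anovaComponent_empty, add_sub_cancel_left]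
  have horth : ∀ U V, U ≠ V → ∑ π, inner ℝ (Y U π) (Y V π) = 0 := by
    intro U V hUV
    have hgen : ∀ U V : Finset (Fin d × Fin K), (∃ p ∈ U, p ∉ V) →
        ∑ π, inner ℝ (Y U π) (Y V π) = 0 := by
      rintro U V ⟨p, hpU, hpV⟩
      simp only [Y, sum_inner, inner_sum]
      rw [Finset.sum_comm]
      refine Finset.sum_eq_zero fun i _ => ?_
      rw [Finset.sum_comm]
      exact Finset.sum_eq_zero fun i' _ =>
        sum_inner_anovaComponent_scrambleTable f hpU (Or.inl hpV)
    by_cases h : ∃ p ∈ U, p ∉ V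
    · exact hgen U V h
    · by_cases h' : ∃ p ∈ V, p ∉ U
      · simpa only [real_inner_comm] using hgen V U h'
      · push Not at h h'
        exact absurd (Finset.Subset.antisymm h h') hUV
  have hpyth : ∑ π, ‖∑ U ∈ Finset.univ.erase ∅, Y U π‖ ^ 2
      = ∑ U ∈ Finset.univ.erase ∅, ∑ π, ‖Y U π‖ ^ 2 := by
    simp only [← real_inner_self_eq_norm_sq, sum_inner, inner_sum]
    rw [Finset.sum_comm]
    refine Finset.sum_congr rfl fun U hU => ?_
    rw [Finset.sum_comm, Finset.sum_eq_single_of_mem U hU]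
    exact fun V _ hV => horth V U hV
  simp only [hY]
  rw [hpyth, Finset.mul_sum, ← sum_norm_sq_anovaComponent f, Finset.mul_sum]
  refine (Finset.sum_le_sum fun U hU => sum_norm_sq_sum_anovaComponent_le ha htm f
    (Finset.nonempty_iff_ne_empty.2 (Finset.ne_of_mem_erase hU))).trans ?_
  exact Finset.sum_le_sum_of_subset_of_nonneg (Finset.erase_subset _ _)
    fun U _ _ => by positivity

end FiniteScrambling

/-! ### Base-`b` digits, elementary intervals and nets. -/

section Digits

variable {b : ℕ} [NeZero b]

/-- The integer whose base-`b` digits are the first `k` digits of `x`, the leading one first. -/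
def digitsNat (x : ℕ → Fin b) : ℕ → ℕ
  | 0 => 0
  | k + 1 => b * digitsNat x k + x k

lemma digitsNat_lt (x : ℕ → Fin b) (k : ℕ) : digitsNat x k < b ^ k := by
  induction k with
  | zero => simp [digitsNat]
  | succ k ih =>
    have h := (x k).2
    calc digitsNat x (k + 1) < b * digitsNat x k + b := by simp only [digitsNat]; omega
      _ = b * (digitsNat x k + 1) := by ring
      _ ≤ b * b ^ k := Nat.mul_le_mul_left _ ih
      _ = b ^ (k + 1) := by ring

lemma digitsNat_eq_iff {x y : ℕ → Fin b} {k : ℕ} :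
    digitsNat x k = digitsNat y k ↔ ∀ l < k, x l = y l := by
  induction k with
  | zero => simp [digitsNat]
  | succ k ih =>
    rw [Nat.forall_lt_succ_right, ← ih]
    simp only [digitsNat]
    have hx := (x k).2
    have hy := (y k).2
    have hb := NeZero.pos b
    constructor
    · intro h
      have h1 := congrArg (· / b) h
      have h2 := congrArg (· % b) h
      simp only [Nat.mul_add_div hb, Nat.div_eq_of_lt hx, Nat.div_eq_of_lt hy, add_zero] at h1
      simp only [Nat.mul_add_mod, Nat.mod_eq_of_lt hx, Nat.mod_eq_of_lt hy] at h2
      exact ⟨h1, Fin.ext h2⟩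
    · rintro ⟨h1, h2⟩
      rw [h1, h2]

lemma sum_ofDigitsTerm (x : ℕ → Fin b) (k : ℕ) :
    ∑ l ∈ Finset.range k, Real.ofDigitsTerm x l = digitsNat x k / (b : ℝ) ^ k := by
  have hb : (b : ℝ) ≠ 0 := Nat.cast_ne_zero.2 (NeZero.ne b)
  induction k with
  | zero => simp [digitsNat]
  | succ k ih =>
    rw [Finset.sum_range_succ, ih, Real.ofDigitsTerm, digitsNat]
    push_cast
    field_simp
    ring

lemma digitsNat_digits {a : ℝ} (ha : a ∈ Ico (0 : ℝ) 1) (k : ℕ) :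
    digitsNat (Real.digits a b) k = ⌊a * (b : ℝ) ^ k⌋₊ := by
  have hb : (b : ℝ) ^ k ≠ 0 := pow_ne_zero _ (Nat.cast_ne_zero.2 (NeZero.ne b))
  have h := Real.ofDigits_digits_sum_eq (b := b) ha k
  rw [sum_ofDigitsTerm, mul_div_cancel₀ _ hb, mul_comm] at h
  exact_mod_cast h

end Digits

section Cells

variable {b d t m : ℕ} [NeZero b]

lemma mem_elementaryInterval_iff {κ : Fin d → ℕ} {c : ∀ j, Fin (b ^ κ j)} {y : Fin d → ℝ}
    (hy : ∀ j, 0 ≤ y j) :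
    y ∈ elementaryInterval b κ c ↔ ∀ j, ⌊y j * (b : ℝ) ^ κ j⌋₊ = c j := by
  have hb : (0 : ℝ) < b := Nat.cast_pos.2 (NeZero.pos b)
  refine forall_congr' fun j => ?_
  rw [Nat.floor_eq_iff (by have := hy j; positivity), div_le_iff₀ (by positivity),
    lt_div_iff₀ (by positivity)]

/-- The `b ^ (m - t)` cells of one shape are disjoint and hold `b ^ t` points each, so they already
account for all `b ^ m` points. -/
lemma IsNet.exists_mem_elementaryInterval {a : Fin (b ^ m) → Fin d → ℝ} (ha : IsNet b t m a)
    {κ : Fin d → ℕ} (hκ : ∑ j, κ j + t = m) (i : Fin (b ^ m)) :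
    ∃ c : ∀ j, Fin (b ^ κ j), a i ∈ elementaryInterval b κ c := by
  classical
  let φ : (Σ c : ∀ j, Fin (b ^ κ j), {i // a i ∈ elementaryInterval b κ c}) → Fin (b ^ m) :=
    fun s => s.2.1
  have hinj : Function.Injective φ := by
    rintro ⟨c, i, hi⟩ ⟨c', i', hi'⟩ (h : i = i')
    subst h
    have hnn : ∀ j, 0 ≤ a i j := fun j => (ha.mem i).1 j
    have hc : c = c' := by
      ext j
      rw [← (mem_elementaryInterval_iff hnn).1 hi j, (mem_elementaryInterval_iff hnn).1 hi' j]
    subst hc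
    rfl
  have hcard : Fintype.card (Σ c : ∀ j, Fin (b ^ κ j), {i // a i ∈ elementaryInterval b κ c})
      = Fintype.card (Fin (b ^ m)) := by
    rw [Fintype.card_sigma]
    have : ∀ c : ∀ j, Fin (b ^ κ j),
        Fintype.card {i // a i ∈ elementaryInterval b κ c} = b ^ t := fun c => by
      rw [← Nat.card_eq_fintype_card, ha.count κ hκ c]
    simp only [this, Finset.sum_const, Finset.card_univ, Fintype.card_pi, Fintype.card_fin,
      smul_eq_mul]
    rw [Finset.prod_pow_eq_pow_sum, ← pow_add, hκ]
  obtain ⟨s, hs⟩ := ((Fintype.bijective_iff_injective_and_card φ).2 ⟨hinj, hcard⟩).2 i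
  exact ⟨s.1, hs ▸ s.2.2⟩

/-- Net points lie in the closed cube by definition; the value `1`, at which the digit expansion
would fail, is excluded by the count. -/
lemma IsNet.mem_Ico {a : Fin (b ^ m) → Fin d → ℝ} (ha : IsNet b t m a) (i : Fin (b ^ m))
    (j : Fin d) : a i j ∈ Ico (0 : ℝ) 1 := by
  refine ⟨(ha.mem i).1 j, ?_⟩
  have hb : (0 : ℝ) < b := Nat.cast_pos.2 (NeZero.pos b)
  obtain ⟨κ, -, hκ⟩ := exists_ge_sum_eq (0 : Fin d → ℕ) j (N := m - t) (by simp)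
  obtain ⟨c, hc⟩ := ha.exists_mem_elementaryInterval (κ := κ) (by have := ha.le; omega) i
  refine (hc j).2.trans_le ?_
  rw [div_le_one (by positivity)]
  exact_mod_cast (c j).2

/-- The table of the first `K` digits of each coordinate. -/
def digitTable (b K : ℕ) [NeZero b] (y : Fin d → ℝ) (p : Fin d × Fin K) : Fin b :=
  Real.digits (y p.1) b p.2

/-- A row of a table of digits, continued by zeros. -/
def row {K : ℕ} (x : Fin d × Fin K → Fin b) (j : Fin d) (k : ℕ) : Fin b :=
  if h : k < K then x (j, ⟨k, h⟩) else 0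

lemma row_apply {K : ℕ} (x : Fin d × Fin K → Fin b) (p : Fin d × Fin K) :
    row x p.1 p.2 = x p := by
  simp [row]

/-- A cell of volume `b ^ (t - m)` involves at most `m` digits of a coordinate, so tables with `K ≥
m` columns see all of them. -/
lemma IsNet.isNetTable {a : Fin (b ^ m) → Fin d → ℝ} (ha : IsNet b t m a) {K : ℕ} (hK : m ≤ K) :
    IsNetTable t m fun i => digitTable b K (a i) := by
  intro κ hκ x
  rw [← ha.count κ hκ fun j => ⟨digitsNat (row x j) (κ j), digitsNat_lt _ _⟩]
  refine Nat.card_congr (Equiv.subtypeEquivRight fun i => ?_)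
  rw [mem_elementaryInterval_iff fun j => (ha.mem i).1 j]
  simp only [← digitsNat_digits (ha.mem_Ico i _), digitsNat_eq_iff]
  constructor
  · intro h j k hk
    have hkK : k < K := by
      have := Finset.single_le_sum (f := κ) (fun _ _ => Nat.zero_le _) (Finset.mem_univ j)
      omega
    rw [show row x j k = x (j, ⟨k, hkK⟩) from dif_pos hkK]
    exact h (j, ⟨k, hkK⟩) hk
  · intro h p hp
    rw [← row_apply x p]
    exact h p.1 p.2 hp

end Cells

/-! ### The `b`-adic grid and Riemann sums over it. -/

section Grid

variable {b d : ℕ} [NeZero b]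

/-- The point of the grid of mesh `b ^ (-K)` whose digits are given by the table `x`. -/
def gridPoint {K : ℕ} (x : Fin d × Fin K → Fin b) (j : Fin d) : ℝ :=
  digitsNat (row x j) K / (b : ℝ) ^ K

lemma gridPoint_mem_Ico {K : ℕ} (x : Fin d × Fin K → Fin b) (j : Fin d) :
    gridPoint x j ∈ Ico (0 : ℝ) 1 := by
  have hb : (0 : ℝ) < b := Nat.cast_pos.2 (NeZero.pos b)
  refine ⟨by unfold gridPoint; positivity, ?_⟩
  rw [gridPoint, div_lt_one (by positivity)]
  exact_mod_cast digitsNat_lt _ _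

lemma gridPoint_mem_unitCube {K : ℕ} (x : Fin d × Fin K → Fin b) : gridPoint x ∈ unitCube d :=
  ⟨fun j => (gridPoint_mem_Ico x j).1, fun j => (gridPoint_mem_Ico x j).2.le⟩

lemma gridPoint_injective {K : ℕ} :
    Function.Injective (gridPoint : (Fin d × Fin K → Fin b) → Fin d → ℝ) := by
  intro x y h
  have hb : (b : ℝ) ^ K ≠ 0 := pow_ne_zero _ (Nat.cast_ne_zero.2 (NeZero.ne b))
  ext1 p
  have hp := congrFun h p.1
  simp only [gridPoint, div_left_inj' hb, Nat.cast_inj] at hp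
  rw [← row_apply x p, ← row_apply y p]
  exact digitsNat_eq_iff.1 hp p.2 p.2.2

lemma exists_gridPoint_eq {K : ℕ} {y : Fin d → ℝ} (hy : ∀ j, y j ∈ Ico (0 : ℝ) 1)
    {z : Fin d → ℤ} (hz : ∀ j, (z j : ℝ) = (b : ℝ) ^ K * y j) :
    ∃ x : Fin d × Fin K → Fin b, gridPoint x = y := by
  have hb : (b : ℝ) ^ K ≠ 0 := pow_ne_zero _ (Nat.cast_ne_zero.2 (NeZero.ne b))
  refine ⟨digitTable b K y, ?_⟩
  ext1 j
  have h : digitsNat (row (digitTable b K y) j) K = digitsNat (Real.digits (y j) b) K := by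
    rw [digitsNat_eq_iff]
    intro l hl
    simp [row, hl, digitTable]
  have hz0 : 0 ≤ z j := by
    have : (0 : ℝ) ≤ z j := by rw [hz]; have := (hy j).1; positivity
    exact_mod_cast this
  lift z j to ℕ using hz0 with n hn
  have hj := hz j
  rw [← hn] at hj
  rw [gridPoint, h, digitsNat_digits (hy j), mul_comm, ← hj, div_eq_iff hb, mul_comm (y j), ← hj]
  simp

end Grid

section RiemannSums

variable {b d : ℕ} [NeZero b]

open scoped Pointwise in
-- Puts the grid in the form required by `tendsto_tsum_div_pow_atTop_integral`. The cube is
-- half-open because grid points have coordinates below `1`.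
lemma pi_Ico_inter_lattice_eq_range_gridPoint (b d K : ℕ) [NeZero b] :
    (Set.pi univ fun _ : Fin d => Ico (0 : ℝ) 1) ∩ (((b ^ K : ℕ) : ℝ)⁻¹ •
        (Submodule.span ℤ (Set.range (Pi.basisFun ℝ (Fin d))) : Set (Fin d → ℝ)))
      = Set.range (gridPoint : (Fin d × Fin K → Fin b) → Fin d → ℝ) := by
  have hb : (b : ℝ) ^ K ≠ 0 := pow_ne_zero _ (Nat.cast_ne_zero.2 (NeZero.ne b))
  ext y
  rw [← Submodule.coe_pointwise_smul, Set.mem_inter_iff, SetLike.mem_coe,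
    BoxIntegral.unitPartition.mem_smul_span_iff, Set.mem_univ_pi]
  constructor
  · rintro ⟨h1, h2⟩
    choose z hz using h2
    obtain ⟨x, hx⟩ := exists_gridPoint_eq (K := K) h1 (z := z) fun j => by simpa using hz j
    exact ⟨x, hx⟩
  · rintro ⟨x, rfl⟩
    refine ⟨gridPoint_mem_Ico x, fun j => ⟨digitsNat (row x j) K, ?_⟩⟩
    simp only [gridPoint, algebraMap_int_eq, eq_intCast]
    push_cast
    rw [mul_div_cancel₀ _ hb]

open scoped Pointwise in
lemma tendsto_gridSum_integral_real (hb : 2 ≤ b) {F : (Fin d → ℝ) → ℝ} (hF : Continuous F) :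
    Tendsto (fun K : ℕ => ((b : ℝ) ^ Fintype.card (Fin d × Fin K))⁻¹ *
        ∑ x : Fin d × Fin K → Fin b, F (gridPoint x))
      atTop (nhds (∫ y in unitCube d, F y)) := by
  have hconv : Convex ℝ (Set.pi univ fun _ : Fin d => Ico (0 : ℝ) 1) :=
    convex_pi fun _ _ => convex_Ico 0 1
  have hlim := tendsto_tsum_div_pow_atTop_integral
    (Set.pi univ fun _ : Fin d => Ico (0 : ℝ) 1) F hF
    (Bornology.IsBounded.pi fun _ => Metric.isBounded_Ico 0 1)
    (MeasurableSet.univ_pi fun _ => measurableSet_Ico)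
    (hconv.addHaar_frontier volume)
  have hset : ∫ y in unitCube d, F y = ∫ y in Set.pi univ fun _ : Fin d => Ico (0 : ℝ) 1, F y :=
    (setIntegral_congr_set (Measure.univ_pi_Ico_ae_eq_Icc (f := fun _ : Fin d => (0 : ℝ))
      (g := fun _ => 1))).symm
  rw [hset]
  refine (hlim.comp (tendsto_pow_atTop_atTop_of_one_lt (by omega : 1 < b))).congr fun K => ?_
  simp only [Function.comp_apply]
  rw [pi_Ico_inter_lattice_eq_range_gridPoint,
    ← (Equiv.ofInjective _ (gridPoint_injective (b := b) (d := d) (K := K))).tsum_eq, tsum_fintype]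
  simp only [Equiv.ofInjective_apply, Fintype.card_prod, Fintype.card_fin]
  rw [div_eq_inv_mul]
  push_cast
  rw [← pow_mul, mul_comm K d]

variable {A : Type*} [NormedAddCommGroup A] [InnerProductSpace ℝ A] [FiniteDimensional ℝ A]

lemma integrableOn_unitCube {E : Type*} [NormedAddCommGroup E]
    {F : (Fin d → ℝ) → E} (hF : Continuous F) : IntegrableOn F (unitCube d) :=
  hF.integrableOn_Icc

lemma tendsto_gridSum_integral (hb : 2 ≤ b) {F : (Fin d → ℝ) → A} (hF : Continuous F) :
    Tendsto (fun K : ℕ => ((b : ℝ) ^ Fintype.card (Fin d × Fin K))⁻¹ •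
        ∑ x : Fin d × Fin K → Fin b, F (gridPoint x))
      atTop (nhds (∫ y in unitCube d, F y)) := by
  have : CompleteSpace A := FiniteDimensional.complete ℝ A
  let e := stdOrthonormalBasis ℝ A
  rw [← e.sum_repr' (∫ y in unitCube d, F y)]
  have h : Tendsto (fun K : ℕ => ∑ i, (((b : ℝ) ^ Fintype.card (Fin d × Fin K))⁻¹ *
      ∑ x : Fin d × Fin K → Fin b, inner ℝ (e i) (F (gridPoint x))) • e i) atTop
      (nhds (∑ i, inner ℝ (e i) (∫ y in unitCube d, F y) • e i)) := by
    refine tendsto_finsetSum _ fun i _ => Tendsto.smul_const ?_ _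
    have hi : Continuous fun y => (inner ℝ (e i) (F y) : ℝ) := continuous_const.inner hF
    have hint : ∫ y in unitCube d, (inner ℝ (e i) (F y) : ℝ)
        = inner ℝ (e i) (∫ y in unitCube d, F y) :=
      integral_inner (integrableOn_unitCube hF) (e i)
    rw [← hint]
    have hlim := tendsto_gridSum_integral_real hb hi
    beta_reduce at hlim
    exact hlim
  refine h.congr fun K => ?_
  refine Eq.trans (Finset.sum_congr rfl fun i _ => ?_) (e.sum_repr' _)
  rw [inner_smul_right, inner_sum]

end RiemannSums

/-! ### Law of the truncated permutations and truncation error. -/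

section Law

variable {b d : ℕ} {Ω : Type*} [MeasurableSpace Ω] {P : Measure Ω}
  {π : Fin d → List (Fin b) → Ω → Equiv.Perm (Fin b)}

/-- The permutations of a nested scrambling that are attached to words of fewer than `K`
digits. -/
def truncatedPerms (K : ℕ) (π : Fin d → List (Fin b) → Ω → Equiv.Perm (Fin b)) (ω : Ω)
    (s : Node b d K) : Equiv.Perm (Fin b) :=
  π s.1 (List.ofFn s.2.2) ω

lemma IsUniformScrambling.measurableSet_truncatedPerms (h : IsUniformScrambling P π) {K : ℕ}
    (p : Node b d K → Equiv.Perm (Fin b)) : MeasurableSet {ω | truncatedPerms K π ω = p} := by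
  have : {ω | truncatedPerms K π ω = p} = ⋂ s, {ω | π s.1 (List.ofFn s.2.2) ω = p s} := by
    ext ω
    simp [truncatedPerms, funext_iff]
  rw [this]
  exact MeasurableSet.iInter fun s => h.measurable _ _ _

/-- Different nodes carry different pairs of coordinate and word, so independence multiplies the
uniform probabilities. -/
lemma IsUniformScrambling.measure_truncatedPerms (h : IsUniformScrambling P π) {K : ℕ}
    (p : Node b d K → Equiv.Perm (Fin b)) :
    P {ω | truncatedPerms K π ω = p}
      = (Fintype.card (Node b d K → Equiv.Perm (Fin b)) : ℝ≥0∞)⁻¹ := by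
  have hinj : Function.Injective fun s : Node b d K => (s.1, List.ofFn s.2.2) := by
    rintro ⟨j, k, w⟩ ⟨j', k', w'⟩ hs
    simp only [Prod.mk.injEq] at hs
    obtain ⟨rfl, hw⟩ := hs
    have hk : k = k' := Fin.ext (by simpa using congrArg List.length hw)
    subst hk
    rw [List.ofFn_injective hw]
  have hind := (h.indep.precomp hinj).measure_inter_preimage_eq_mul Finset.univ
    (sets := fun s => {p s}) fun _ _ => trivial
  have hset : {ω | truncatedPerms K π ω = p}
      = ⋂ s ∈ (Finset.univ : Finset (Node b d K)), π s.1 (List.ofFn s.2.2) ⁻¹' {p s} := by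
    ext ω
    simp [truncatedPerms, funext_iff]
  rw [hset, hind]
  have huni : ∀ s : Node b d K, P (π s.1 (List.ofFn s.2.2) ⁻¹' {p s})
      = ((b.factorial : ℕ) : ℝ≥0∞)⁻¹ := fun s => h.uniform _ _ _
  simp only [huni, Finset.prod_const, Finset.card_univ, Fintype.card_fun, Fintype.card_perm,
    Fintype.card_fin]
  rw [Nat.cast_pow, ENNReal.inv_pow]

lemma IsUniformScrambling.lintegral_truncatedPerms (h : IsUniformScrambling P π) {K : ℕ}
    (Φ : (Node b d K → Equiv.Perm (Fin b)) → ℝ≥0∞) :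
    ∫⁻ ω, Φ (truncatedPerms K π ω) ∂P
      = (Fintype.card (Node b d K → Equiv.Perm (Fin b)) : ℝ≥0∞)⁻¹ * ∑ p, Φ p := by
  let M : MeasurableSpace (Node b d K → Equiv.Perm (Fin b)) := ⊤
  have hR : Measurable (truncatedPerms K π) :=
    measurable_to_countable' fun p => h.measurableSet_truncatedPerms p
  rw [← lintegral_map (μ := P) (f := Φ) (fun _ _ => trivial) hR, lintegral_fintype,
    Finset.mul_sum]
  refine Finset.sum_congr rfl fun p _ => ?_
  rw [Measure.map_apply hR trivial, mul_comm]
  congr 1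
  exact h.measure_truncatedPerms p

variable [NeZero b]

lemma scramble_mem_Icc (π : List (Fin b) → Equiv.Perm (Fin b)) (y : ℝ) :
    scramble π y ∈ Icc (0 : ℝ) 1 :=
  ⟨Real.ofDigits_nonneg _, Real.ofDigits_le_one _⟩

/-- The first `K` scrambled digits use only the first `K` digits and words shorter than `K`, so both
points share them and differ by a tail of at most `b ^ (-K)`. -/
lemma abs_scramble_sub_gridPoint_le (K : ℕ) (ω : Ω) (y : Fin d → ℝ) (j : Fin d) :
    |scramble (fun w => π j w ω) (y j)
      - gridPoint (scrambleTable (truncatedPerms K π ω) (digitTable b K y)) j|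
      ≤ ((b : ℝ) ^ K)⁻¹ := by
  rw [gridPoint, ← sum_ofDigitsTerm, scramble, Real.ofDigits_eq_sum_add_ofDigits _ K]
  set v : ℕ → Fin b := fun k => π j (List.ofFn fun l : Fin k => Real.digits (y j) b l) ω
    (Real.digits (y j) b k)
  have h : ∀ l ∈ Finset.range K, Real.ofDigitsTerm v l
      = Real.ofDigitsTerm (row (scrambleTable (truncatedPerms K π ω) (digitTable b K y)) j) l := by
    intro l hl
    have hl' := Finset.mem_range.1 hl
    simp only [Real.ofDigitsTerm, row, hl', dif_pos]
    rfl
  rw [Finset.sum_congr rfl h, add_sub_cancel_left, abs_of_nonneg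
    (mul_nonneg (by positivity) (Real.ofDigits_nonneg _))]
  exact mul_le_of_le_one_right (by positivity) (Real.ofDigits_le_one _)

end Law

/-! ### The variance bound for continuous integrands. -/

section VarianceBound

variable {b d t m : ℕ} [NeZero b] {Ω : Type*} [MeasurableSpace Ω] {P : Measure Ω}
  {A : Type*} [NormedAddCommGroup A] [InnerProductSpace ℝ A]

lemma lintegral_norm_sq_scrambleTable_le {K : ℕ}
    {π : Fin d → List (Fin b) → Ω → Equiv.Perm (Fin b)} (hπ : IsUniformScrambling P π)
    {a : Fin (b ^ m) → Fin d × Fin K → Fin b} (ha : IsNetTable t m a) (htm : t ≤ m)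
    (f : (Fin d × Fin K → Fin b) → A) :
    ∫⁻ ω, ENNReal.ofReal (‖((b ^ m : ℕ) : ℝ)⁻¹ • ∑ i, (f (scrambleTable (truncatedPerms K π ω) (a i))
        - ((b : ℝ) ^ Fintype.card (Fin d × Fin K))⁻¹ • ∑ y, f y)‖ ^ 2) ∂P
      ≤ ENNReal.ofReal ((b : ℝ) ^ (t + d) / ((b ^ m : ℕ) : ℝ) *
        (((b : ℝ) ^ Fintype.card (Fin d × Fin K))⁻¹ * ∑ x, ‖f x‖ ^ 2)) := by
  have key := sum_norm_sq_sum_scrambleTable_le ha htm f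
  rw [hπ.lintegral_truncatedPerms fun p => ENNReal.ofReal (‖((b ^ m : ℕ) : ℝ)⁻¹ •
    ∑ i, (f (scrambleTable p (a i))
      - ((b : ℝ) ^ Fintype.card (Fin d × Fin K))⁻¹ • ∑ y, f y)‖ ^ 2)]
  have hG : (0 : ℝ) < Fintype.card (Node b d K → Equiv.Perm (Fin b)) :=
    Nat.cast_pos.2 Fintype.card_pos
  rw [← ENNReal.ofReal_sum_of_nonneg fun p _ => by positivity, ← ENNReal.ofReal_natCast,
    ← ENNReal.ofReal_inv_of_pos hG, ← ENNReal.ofReal_mul (by positivity)]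
  refine ENNReal.ofReal_le_ofReal ?_
  have hb : (0 : ℝ) < b := Nat.cast_pos.2 (NeZero.pos b)
  have hn : (0 : ℝ) < ((b ^ m : ℕ) : ℝ) := by push_cast; positivity
  simp only [norm_smul, mul_pow, ← Finset.mul_sum, norm_inv, Real.norm_natCast]
  rw [Fintype.card_fun, Fintype.card_fin, Fintype.card_fin, Nat.cast_pow] at key
  generalize hS : ∑ p, ‖∑ i, (f (scrambleTable p (a i))
      - ((b : ℝ) ^ Fintype.card (Fin d × Fin K))⁻¹ • ∑ y, f y)‖ ^ 2 = S at key ⊢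
  generalize ∑ x, ‖f x‖ ^ 2 = V at key ⊢
  generalize ((b ^ m : ℕ) : ℝ) = n at *
  generalize (Fintype.card (Node b d K → Equiv.Perm (Fin b)) : ℝ) = G at *
  have hX : (0 : ℝ) < (b : ℝ) ^ Fintype.card (Fin d × Fin K) := by positivity
  generalize (b : ℝ) ^ Fintype.card (Fin d × Fin K) = X at *
  rw [show G⁻¹ * (n⁻¹ ^ 2 * S) = (X * S) / (X * G * n ^ 2) by field_simp,
    div_le_iff₀ (by positivity)]
  refine key.trans (le_of_eq ?_)
  field_simp

variable [FiniteDimensional ℝ A]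

lemma isCompact_unitCube : IsCompact (unitCube d) := isCompact_Icc

lemma IsScrambledNet.mem_unitCube {Y : Fin (b ^ m) → Ω → Fin d → ℝ}
    (hY : IsScrambledNet b t m P Y) (i : Fin (b ^ m)) (ω : Ω) : Y i ω ∈ unitCube d := by
  obtain ⟨a, π, -, -, h⟩ := hY
  refine ⟨fun j => ?_, fun j => ?_⟩
  · rw [h]; exact (scramble_mem_Icc _ _).1
  · rw [h]; exact (scramble_mem_Icc _ _).2

lemma tendsto_inv_pow_atTop (hb : 2 ≤ b) :
    Tendsto (fun K : ℕ => ((b : ℝ) ^ K)⁻¹) atTop (nhds 0) :=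
  (tendsto_pow_atTop_atTop_of_one_lt (by exact_mod_cast hb : (1 : ℝ) < b)).inv_tendsto_atTop

lemma lintegral_enorm_sq_le_of_integral_eq_zero [IsProbabilityMeasure P] (hb : 2 ≤ b)
    {Y : Fin (b ^ m) → Ω → Fin d → ℝ} (hY : IsScrambledNet b t m P Y) {ψ : (Fin d → ℝ) → A}
    (hψ : Continuous ψ) (h0 : ∫ y in unitCube d, ψ y = 0) :
    ∫⁻ ω, ‖((b ^ m : ℕ) : ℝ)⁻¹ • ∑ i, ψ (Y i ω)‖ₑ ^ 2 ∂P
      ≤ ENNReal.ofReal ((b : ℝ) ^ (t + d) / ((b ^ m : ℕ) : ℝ) *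
        ∫ y in unitCube d, ‖ψ y‖ ^ 2) := by
  have hYc := hY.mem_unitCube
  obtain ⟨a, π, ha, hπ, hYa⟩ := hY
  obtain ⟨B, hB⟩ := isCompact_unitCube.exists_bound_of_continuousOn
    (s := unitCube d) hψ.continuousOn
  have hB0 : 0 ≤ B := (norm_nonneg _).trans (hB 0 ⟨le_rfl, zero_le_one⟩)
  have hn : (0 : ℝ) < ((b ^ m : ℕ) : ℝ) := Nat.cast_pos.2 (pow_pos (NeZero.pos b) m)
  have havg : ∀ (v : Fin (b ^ m) → A) (r : ℝ), (∀ i, ‖v i‖ ≤ r) →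
      ‖((b ^ m : ℕ) : ℝ)⁻¹ • ∑ i, v i‖ ≤ r := by
    intro v r hv
    rw [norm_smul, norm_inv, Real.norm_natCast, inv_mul_le_iff₀ hn]
    calc _ ≤ ∑ i, ‖v i‖ := norm_sum_le _ _
      _ ≤ ∑ _i : Fin (b ^ m), r := Finset.sum_le_sum fun i _ => hv i
      _ = _ := by simp
  let M : ℕ → A := fun K => ((b : ℝ) ^ Fintype.card (Fin d × Fin K))⁻¹ •
    ∑ x : Fin d × Fin K → Fin b, ψ (gridPoint x)
  have hM : Tendsto (fun K => ‖M K‖) atTop (nhds 0) := by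
    have := (tendsto_gridSum_integral hb hψ).norm
    rwa [h0, norm_zero] at this
  let V : ℕ → ℝ := fun K => ((b : ℝ) ^ Fintype.card (Fin d × Fin K))⁻¹ *
    ∑ x : Fin d × Fin K → Fin b, ‖ψ (gridPoint x)‖ ^ 2
  have hV : Tendsto V atTop (nhds (∫ y in unitCube d, ‖ψ y‖ ^ 2)) :=
    tendsto_gridSum_integral_real hb (F := fun y => ‖ψ y‖ ^ 2) (hψ.norm.pow 2)
  have hΓ : (0 : ℝ) ≤ (b : ℝ) ^ (t + d) / ((b ^ m : ℕ) : ℝ) := by positivity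
  -- `δ` bounds the change of `ψ` under truncation, and the zeros are the limit of `‖M K‖`. The
  -- limit `K → ∞` is taken for fixed `δ`, and `δ → 0` afterwards.
  have hδ : ∀ δ > 0, ∫⁻ ω, ‖((b ^ m : ℕ) : ℝ)⁻¹ • ∑ i, ψ (Y i ω)‖ₑ ^ 2 ∂P
      ≤ ENNReal.ofReal ((b : ℝ) ^ (t + d) / ((b ^ m : ℕ) : ℝ) *
        (∫ y in unitCube d, ‖ψ y‖ ^ 2) + 2 * B * (δ + 0) + (δ + 0) * (δ + 3 * 0)) := by
    intro δ hδ
    obtain ⟨η, hη, hunif⟩ := Metric.uniformContinuousOn_iff.1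
      (isCompact_unitCube.uniformContinuousOn_of_continuous hψ.continuousOn) δ hδ
    have hlim : Tendsto (fun K => ENNReal.ofReal ((b : ℝ) ^ (t + d) / ((b ^ m : ℕ) : ℝ) * V K
        + 2 * B * (δ + ‖M K‖) + (δ + ‖M K‖) * (δ + 3 * ‖M K‖))) atTop
        (nhds (ENNReal.ofReal ((b : ℝ) ^ (t + d) / ((b ^ m : ℕ) : ℝ) *
        (∫ y in unitCube d, ‖ψ y‖ ^ 2) + 2 * B * (δ + 0) + (δ + 0) * (δ + 3 * 0)))) :=
      ENNReal.tendsto_ofReal (((hV.const_mul _).add ((hM.const_add δ).const_mul _)).add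
        ((hM.const_add δ).mul ((hM.const_mul 3).const_add δ)))
    refine ge_of_tendsto hlim ?_
    filter_upwards [eventually_ge_atTop m, (tendsto_inv_pow_atTop hb).eventually_lt_const hη]
      with K hmK hKη
    let Z : Ω → Fin (b ^ m) → Fin d × Fin K → Fin b := fun ω i =>
      scrambleTable (truncatedPerms K π ω) (digitTable b K (a i))
    have hfin := lintegral_norm_sq_scrambleTable_le hπ (ha.isNetTable hmK) ha.le
      fun x => ψ (gridPoint x)
    have hpt : ∀ ω, ‖((b ^ m : ℕ) : ℝ)⁻¹ • ∑ i, ψ (Y i ω)‖ₑ ^ 2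
        ≤ ENNReal.ofReal (‖((b ^ m : ℕ) : ℝ)⁻¹ • ∑ i, (ψ (gridPoint (Z ω i)) - M K)‖ ^ 2)
          + ENNReal.ofReal (2 * B * (δ + ‖M K‖) + (δ + ‖M K‖) * (δ + 3 * ‖M K‖)) := by
      intro ω
      have hM0 := norm_nonneg (M K)
      rw [← ofReal_norm, ← ENNReal.ofReal_pow (norm_nonneg _),
        ← ENNReal.ofReal_add (by positivity) (by positivity)]
      refine ENNReal.ofReal_le_ofReal ?_
      have h1 : ∀ i, ‖ψ (Y i ω) - (ψ (gridPoint (Z ω i)) - M K)‖ ≤ δ + ‖M K‖ := by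
        intro i
        have hdist : dist (Y i ω) (gridPoint (Z ω i)) < η := by
          refine lt_of_le_of_lt ((dist_pi_le_iff (by positivity)).2 fun j => ?_) hKη
          rw [Real.dist_eq, hYa]
          exact abs_scramble_sub_gridPoint_le K ω (a i) j
        have := hunif _ (hYc i ω) _ (gridPoint_mem_unitCube _) hdist
        rw [dist_eq_norm] at this
        rw [sub_sub_eq_add_sub, add_sub_right_comm]
        exact (norm_add_le _ _).trans (add_le_add this.le le_rfl)
      have h2 : ∀ i, ‖ψ (gridPoint (Z ω i)) - M K‖ ≤ B + ‖M K‖ := fun i =>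
        (norm_sub_le _ _).trans (add_le_add (hB _ (gridPoint_mem_unitCube _)) le_rfl)
      have h3 := havg _ _ h1
      have h4 := havg _ _ h2
      rw [Finset.sum_sub_distrib, smul_sub] at h3
      have h5 := norm_le_norm_add_norm_sub' (((b ^ m : ℕ) : ℝ)⁻¹ • ∑ i, ψ (Y i ω))
        (((b ^ m : ℕ) : ℝ)⁻¹ • ∑ i, (ψ (gridPoint (Z ω i)) - M K))
      have h6 := norm_nonneg (((b ^ m : ℕ) : ℝ)⁻¹ • ∑ i, ψ (Y i ω))
      have h7 := norm_nonneg (((b ^ m : ℕ) : ℝ)⁻¹ • ∑ i, (ψ (gridPoint (Z ω i)) - M K))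
      have h8 := h5.trans (add_le_add le_rfl h3)
      have h9 := pow_le_pow_left₀ h6 h8 2
      -- With `e = δ + ‖M K‖` and a main term `a ≤ B + ‖M K‖`, `(a + e)² ≤ a² + 2(B + ‖M K‖)e + e² =
      -- a² + 2Be + e(δ + 3‖M K‖)`.
      nlinarith [mul_le_mul_of_nonneg_right h4 (by positivity : 0 ≤ δ + ‖M K‖)]
    refine (lintegral_mono hpt).trans ?_
    rw [lintegral_add_right _ measurable_const, lintegral_const, measure_univ, mul_one, add_assoc]
    have hM0 := norm_nonneg (M K)
    rw [ENNReal.ofReal_add (mul_nonneg hΓ (by positivity)) (by positivity)]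
    exact add_le_add hfin le_rfl
  have hlim : Tendsto (fun δ : ℝ => ENNReal.ofReal ((b : ℝ) ^ (t + d) / ((b ^ m : ℕ) : ℝ) *
        (∫ y in unitCube d, ‖ψ y‖ ^ 2) + 2 * B * (δ + 0) + (δ + 0) * (δ + 3 * 0)))
      (nhdsWithin 0 (Ioi 0)) (nhds (ENNReal.ofReal ((b : ℝ) ^ (t + d) / ((b ^ m : ℕ) : ℝ) *
        (∫ y in unitCube d, ‖ψ y‖ ^ 2) + 2 * B * (0 + 0) + (0 + 0) * (0 + 3 * 0)))) := by
    refine ((ENNReal.continuous_ofReal.comp ?_).tendsto 0).mono_left nhdsWithin_le_nhds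
    fun_prop
  have := ge_of_tendsto hlim (eventually_nhdsWithin_of_forall hδ)
  simpa using this

lemma volume_unitCube : volume (unitCube d) = 1 := by
  simp [unitCube, Real.volume_Icc_pi]

/-- The variance of a scrambled net is at most `b ^ (t + d)` times that of simple Monte Carlo. -/
theorem lintegral_enorm_sub_integral_sq_le [IsProbabilityMeasure P] (hb : 2 ≤ b)
    {Y : Fin (b ^ m) → Ω → Fin d → ℝ} (hY : IsScrambledNet b t m P Y) {φ : (Fin d → ℝ) → A}
    (hφ : Continuous φ) :
    ∫⁻ ω, ‖((b ^ m : ℕ) : ℝ)⁻¹ • ∑ i, φ (Y i ω) - ∫ y in unitCube d, φ y‖ₑ ^ 2 ∂P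
      ≤ ((b ^ (t + d) : ℕ) : ℝ≥0) *
        (∫⁻ y in unitCube d, ‖φ y - ∫ y in unitCube d, φ y‖ₑ ^ 2) / ((b ^ m : ℕ) : ℝ≥0∞) := by
  have : CompleteSpace A := FiniteDimensional.complete ℝ A
  have hreal : volume.real (unitCube d) = 1 := by simp [Measure.real, volume_unitCube]
  set c := ∫ y in unitCube d, φ y with hc
  have hψ : Continuous fun y => φ y - c := hφ.sub continuous_const
  have h0 : ∫ y in unitCube d, (φ y - c) = 0 := by
    rw [integral_sub (integrableOn_unitCube hφ) (integrableOn_unitCube continuous_const),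
      setIntegral_const, hreal, one_smul, sub_self]
  have hn : (0 : ℝ) < ((b ^ m : ℕ) : ℝ) := Nat.cast_pos.2 (pow_pos (NeZero.pos b) m)
  have key := lintegral_enorm_sq_le_of_integral_eq_zero hb hY hψ h0
  have hsum : ∀ ω, ((b ^ m : ℕ) : ℝ)⁻¹ • ∑ i, (φ (Y i ω) - c)
      = ((b ^ m : ℕ) : ℝ)⁻¹ • ∑ i, φ (Y i ω) - c := by
    intro ω
    rw [Finset.sum_sub_distrib, smul_sub, Finset.sum_const, Finset.card_univ, Fintype.card_fin,
      ← Nat.cast_smul_eq_nsmul ℝ, inv_smul_smul₀ hn.ne']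
  simp only [hsum] at key
  refine key.trans (le_of_eq ?_)
  have hint : ENNReal.ofReal (∫ y in unitCube d, ‖φ y - c‖ ^ 2)
      = ∫⁻ y in unitCube d, ‖φ y - c‖ₑ ^ 2 := by
    have hsq : Continuous fun y => ‖φ y - c‖ ^ 2 := hψ.norm.pow 2
    rw [ofReal_integral_eq_lintegral_ofReal (integrableOn_unitCube hsq)
      (Eventually.of_forall fun y => sq_nonneg _)]
    refine lintegral_congr fun y => ?_
    rw [ENNReal.ofReal_pow (norm_nonneg _), ofReal_norm]
  rw [ENNReal.ofReal_mul (by positivity), hint, ENNReal.ofReal_div_of_pos hn,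
    ENNReal.ofReal_natCast, div_eq_mul_inv, div_eq_mul_inv, mul_right_comm]
  congr 2
  rw [← Nat.cast_pow, ENNReal.ofReal_natCast]
  simp

end VarianceBound

/-! ### Continuous extension from the cube. -/

section Clamp

variable {d : ℕ}

/-- The coordinatewise projection onto the unit cube. -/
def clamp (z : Fin d → ℝ) (j : Fin d) : ℝ := max 0 (min 1 (z j))

@[fun_prop]
lemma continuous_clamp : Continuous (clamp : (Fin d → ℝ) → Fin d → ℝ) := by
  unfold clamp
  fun_prop

lemma clamp_mem (z : Fin d → ℝ) : clamp z ∈ unitCube d :=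
  ⟨fun _ => le_max_left _ _, fun _ => max_le zero_le_one (min_le_left _ _)⟩

lemma clamp_of_mem {z : Fin d → ℝ} (hz : z ∈ unitCube d) : clamp z = z := by
  ext j
  have h0 : 0 ≤ z j := hz.1 j
  have h1 : z j ≤ 1 := hz.2 j
  simp [clamp, h0, h1]

lemma sub_mem_Icc {x y : Fin d → ℝ} (hx : x ∈ unitCube d) (hy : y ∈ unitCube d) :
    x - y ∈ Icc (-1 : Fin d → ℝ) 1 := by
  refine ⟨fun j => ?_, fun j => ?_⟩
  · have h1 : 0 ≤ x j := hx.1 j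
    have h2 : y j ≤ 1 := hy.2 j
    simp only [Pi.neg_apply, Pi.one_apply, Pi.sub_apply]; linarith
  · have h1 : 0 ≤ y j := hy.1 j
    have h2 : x j ≤ 1 := hx.2 j
    simp only [Pi.one_apply, Pi.sub_apply]; linarith

lemma update_mem_unitCube {x : Fin d → ℝ} (hx : x ∈ unitCube d) (j : Fin d) {s : ℝ}
    (hs : s ∈ Icc (0 : ℝ) 1) : Function.update x j s ∈ unitCube d := by
  refine ⟨fun i => ?_, fun i => ?_⟩
  · by_cases h : i = j
    · subst h; simpa using hs.1
    · simpa [h] using hx.1 i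
  · by_cases h : i = j
    · subst h; simpa using hs.2
    · simpa [h] using hx.2 i

end Clamp

/-! ### The sampling error as a linear functional of the integrand. -/

section SamplingError

variable {d n : ℕ} {A : Type*} [NormedAddCommGroup A] [InnerProductSpace ℝ A]

/-- The error of the sample mean of `F z` over the points `y` as an approximation of its
integral. -/
def samplingError (F : (Fin d → ℝ) → (Fin d → ℝ) → A) (y : Fin n → Fin d → ℝ) (z : Fin d → ℝ) :
    A :=
  (n : ℝ)⁻¹ • ∑ i, F z (y i) - ∫ v in unitCube d, F z v

lemma continuous_samplingError {F : (Fin d → ℝ) → (Fin d → ℝ) → A}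
    (hF : Continuous (Function.uncurry F)) :
    Continuous fun q : (Fin n → Fin d → ℝ) × (Fin d → ℝ) => samplingError F q.1 q.2 := by
  unfold samplingError
  refine Continuous.sub ?_ ?_
  · refine Continuous.const_smul (continuous_finsetSum _ fun i _ => ?_) _
    exact hF.comp (continuous_snd.prodMk ((continuous_apply i).comp continuous_fst))
  · exact (continuous_parametric_integral_of_continuous hF isCompact_unitCube).comp continuous_snd

/-- Both the sample mean and the integral commute with integration in `s`, the latter by Fubini. An
integral identity for the integrand thus passes to the error. -/
lemma samplingError_eq_add_integral [FiniteDimensional ℝ A]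
    {F F' : (Fin d → ℝ) → (Fin d → ℝ) → A}
    (hF : Continuous (Function.uncurry F)) (hF' : Continuous (Function.uncurry F'))
    {x x₀ : Fin d → ℝ} {γ : ℝ → Fin d → ℝ} (hγ : Continuous γ) {r : ℝ}
    (h : ∀ v, F x v = F x₀ v + ∫ s in Icc 0 r, F' (γ s) v) (y : Fin n → Fin d → ℝ) :
    samplingError F y x = samplingError F y x₀ + ∫ s in Icc 0 r, samplingError F' y (γ s) := by
  have : CompleteSpace A := FiniteDimensional.complete ℝ A
  have hcont : Continuous fun p : ℝ × (Fin d → ℝ) => F' (γ p.1) p.2 :=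
    hF'.comp ((hγ.comp continuous_fst).prodMk continuous_snd)
  have hs : ∀ v, Continuous fun s => F' (γ s) v :=
    fun v => hcont.comp (continuous_id.prodMk continuous_const)
  have hpar : Continuous fun s => ∫ v in unitCube d, F' (γ s) v :=
    continuous_parametric_integral_of_continuous hcont isCompact_unitCube
  have hpar' : Continuous fun v => ∫ s in Icc 0 r, F' (γ s) v := by
    refine continuous_parametric_integral_of_continuous (f := fun v s => F' (γ s) v) ?_
      isCompact_Icc
    exact hcont.comp continuous_swap
  have hswap : ∫ v in unitCube d, ∫ s in Icc 0 r, F' (γ s) v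
      = ∫ s in Icc 0 r, ∫ v in unitCube d, F' (γ s) v := by
    refine integral_integral_swap (f := fun v s => F' (γ s) v) ?_
    rw [Measure.prod_restrict]
    exact (hcont.comp continuous_swap).continuousOn.integrableOn_compact
      (isCompact_unitCube.prod isCompact_Icc)
  have hFv : ∀ z, Continuous fun v => F z v :=
    fun z => hF.comp (continuous_const.prodMk continuous_id)
  unfold samplingError
  simp only [h]
  rw [integral_add (integrableOn_unitCube (hFv x₀)) (integrableOn_unitCube hpar'), hswap,
    integral_sub, integral_smul, integral_finsetSum]
  · rw [Finset.sum_add_distrib, smul_add]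
    abel
  · exact fun i _ => (hs (y i)).integrableOn_Icc
  · exact (Continuous.const_smul (continuous_finsetSum _ fun i _ => hs (y i)) _).integrableOn_Icc
  · exact hpar.integrableOn_Icc

end SamplingError

/-! ### Partial derivatives of the kernel and the majorant of the error. -/

section Kernel

variable {d n : ℕ} {A : Type*} [NormedAddCommGroup A] [InnerProductSpace ℝ A]

/-- The partial derivative of the kernel in the direction of the coordinate `j`. -/
def partialDeriv (j : Fin d) (k : (Fin d → ℝ) → A) (z : Fin d → ℝ) : A :=
  fderivWithin ℝ k (Icc (-1) 1) z (Pi.single j 1)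

lemma uniqueDiffOn_Icc_pi : UniqueDiffOn ℝ (Icc (-1 : Fin d → ℝ) 1) := by
  rw [← Set.pi_univ_Icc]
  exact UniqueDiffOn.univ_pi fun j => uniqueDiffOn_Icc (by norm_num)

lemma contDiffOn_partialDeriv {k : (Fin d → ℝ) → A}
    (hk : ContDiffOn ℝ (⊤ : ℕ∞) k (Icc (-1) 1)) (j : Fin d) :
    ContDiffOn ℝ (⊤ : ℕ∞) (partialDeriv j k) (Icc (-1) 1) := by
  have h : ContDiffOn ℝ (⊤ : ℕ∞) (fderivWithin ℝ k (Icc (-1) 1)) (Icc (-1) 1) :=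
    hk.fderivWithin uniqueDiffOn_Icc_pi (by simp)
  exact h.clm_apply contDiffOn_const

variable [FiniteDimensional ℝ A] (mul : A →ₗ[ℝ] A →ₗ[ℝ] A)

/-- The integrand, extended continuously from the unit cube to the whole space. -/
def clampedIntegrand (g k : (Fin d → ℝ) → A) (x y : Fin d → ℝ) : A :=
  integrand mul g k (clamp x) (clamp y)

/-- The product of the value space as a continuous bilinear map. -/
def mulCLM : A →L[ℝ] A →L[ℝ] A :=
  LinearMap.toContinuousLinearMap (LinearMap.toContinuousLinearMap.toLinearMap ∘ₗ mul)

variable {mul} {g k : (Fin d → ℝ) → A}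

lemma continuous_clampedIntegrand (hg : ContinuousOn g (Icc 0 1))
    (hk : ContinuousOn k (Icc (-1) 1)) :
    Continuous (Function.uncurry (clampedIntegrand mul g k)) := by
  have h1 : Continuous fun p : (Fin d → ℝ) × (Fin d → ℝ) => g (clamp p.2) :=
    hg.comp_continuous (by fun_prop) fun p => clamp_mem _
  have h2 : Continuous fun p : (Fin d → ℝ) × (Fin d → ℝ) => k (clamp p.1 - clamp p.2) :=
    hk.comp_continuous (by fun_prop) fun p => sub_mem_Icc (clamp_mem _) (clamp_mem _)
  exact ((mulCLM mul).continuous.comp h1).clm_apply h2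

lemma clampedIntegrand_eq_add_integral (hg : ContinuousOn g (Icc 0 1))
    (hk : ContDiffOn ℝ (⊤ : ℕ∞) k (Icc (-1) 1)) {x : Fin d → ℝ} (hx : x ∈ unitCube d) (j : Fin d)
    (v : Fin d → ℝ) :
    clampedIntegrand mul g k x v = clampedIntegrand mul g k (Function.update x j 0) v
      + ∫ s in Icc 0 (x j), clampedIntegrand mul g (partialDeriv j k) (Function.update x j s) v := by
  have : CompleteSpace A := FiniteDimensional.complete ℝ A
  have hx0 : 0 ≤ x j := hx.1 j
  have hx1 : x j ≤ 1 := hx.2 j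
  have hupd : Continuous fun s : ℝ => Function.update x j s := by fun_prop
  have hcont : ∀ {k : (Fin d → ℝ) → A}, ContDiffOn ℝ (⊤ : ℕ∞) k (Icc (-1) 1) →
      Continuous fun s => clampedIntegrand mul g k (Function.update x j s) v := fun hk =>
    (continuous_clampedIntegrand hg hk.continuousOn).comp (hupd.prodMk continuous_const)
  have hderiv : ∀ s ∈ Ioo 0 (x j), HasDerivAt
      (fun s => clampedIntegrand mul g k (Function.update x j s) v)
      (clampedIntegrand mul g (partialDeriv j k) (Function.update x j s) v) s := by
    intro s hs
    have hs01 : ∀ {s}, s ∈ Icc 0 (x j) → Function.update x j s ∈ unitCube d :=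
      fun hs => update_mem_unitCube hx j ⟨hs.1, hs.2.trans hx1⟩
    have hmaps : MapsTo (fun s => Function.update x j s - clamp v) (Icc 0 (x j)) (Icc (-1) 1) :=
      fun s hs => sub_mem_Icc (hs01 hs) (clamp_mem v)
    have hsI := Ioo_subset_Icc_self hs
    have hd := ((hk.differentiableOn (by simp)) _ (hmaps hsI)).hasFDerivWithinAt
    have hline : HasDerivWithinAt (fun s => Function.update x j s - clamp v)
        (Pi.single j (1 : ℝ)) (Icc 0 (x j)) s :=
      ((hasDerivAt_update x j s).sub_const _).hasDerivWithinAt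
    -- `k` is differentiable only within its cube, and the other coordinates may lie on the
    -- boundary. Along the segment, however, `s` is an interior point, so the derivative in `s` is
    -- two-sided.
    have h1 := (hd.comp_hasDerivWithinAt s hline hmaps).hasDerivAt (Icc_mem_nhds hs.1 hs.2)
    have h2 := (mulCLM mul (g (clamp v))).hasFDerivAt.comp_hasDerivAt s h1
    rw [clampedIntegrand, clamp_of_mem (hs01 hsI)]
    refine h2.congr_of_eventuallyEq ?_
    filter_upwards [Icc_mem_nhds hs.1 hs.2] with s' hs'
    rw [clampedIntegrand, clamp_of_mem (hs01 hs')]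
    rfl
  have h := intervalIntegral.integral_eq_sub_of_hasDerivAt_of_le hx0 (hcont hk).continuousOn
    hderiv ((hcont (contDiffOn_partialDeriv hk j)).intervalIntegrable _ _)
  rw [intervalIntegral.integral_of_le hx0, ← integral_Icc_eq_integral_Ioc,
    Function.update_eq_self] at h
  rw [h, add_sub_cancel]

lemma samplingError_clampedIntegrand_eq (hg : ContinuousOn g (Icc 0 1))
    (hk : ContDiffOn ℝ (⊤ : ℕ∞) k (Icc (-1) 1)) {x : Fin d → ℝ} (hx : x ∈ unitCube d) (j : Fin d)
    (y : Fin n → Fin d → ℝ) :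
    samplingError (clampedIntegrand mul g k) y x
      = samplingError (clampedIntegrand mul g k) y (Function.update x j 0)
        + ∫ s in Icc 0 (x j), samplingError (clampedIntegrand mul g (partialDeriv j k)) y
          (Function.update x j s) :=
  samplingError_eq_add_integral (continuous_clampedIntegrand hg hk.continuousOn)
    (continuous_clampedIntegrand hg (contDiffOn_partialDeriv hk j).continuousOn)
    (by fun_prop) (clampedIntegrand_eq_add_integral hg hk hx j) y

variable (mul) in
/-- A majorant of the sampling error at the points that agree with `z` outside of the listed
coordinates. -/
def majorant (g : (Fin d → ℝ) → A) :
    List (Fin d) → ((Fin d → ℝ) → A) → (Fin n → Fin d → ℝ) → (Fin d → ℝ) → ℝ≥0∞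
  | [], k, y, z => ‖samplingError (clampedIntegrand mul g k) y z‖ₑ
  | j :: l, k, y, z => majorant g l k y (Function.update z j 0) +
      ∫⁻ s in Icc (0 : ℝ) 1, majorant g l (partialDeriv j k) y (Function.update z j s)

lemma measurable_majorant (hg : ContinuousOn g (Icc 0 1)) (l : List (Fin d))
    (hk : ContDiffOn ℝ (⊤ : ℕ∞) k (Icc (-1) 1)) :
    Measurable fun q : (Fin n → Fin d → ℝ) × (Fin d → ℝ) => majorant mul g l k q.1 q.2 := by
  induction l generalizing k with
  | nil =>
    exact (continuous_samplingError
      (continuous_clampedIntegrand hg hk.continuousOn)).enorm.measurable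
  | cons j l ih =>
    simp only [majorant]
    refine Measurable.add ?_ ?_
    · have h : Continuous fun q : (Fin n → Fin d → ℝ) × (Fin d → ℝ) =>
          (q.1, Function.update q.2 j 0) := by fun_prop
      exact (ih hk).comp h.measurable
    · have h : Continuous fun q : ((Fin n → Fin d → ℝ) × (Fin d → ℝ)) × ℝ =>
          (q.1.1, Function.update q.1.2 j q.2) := by fun_prop
      exact Measurable.lintegral_prod_right' ((ih (contDiffOn_partialDeriv hk j)).comp h.measurable)

/-- The majorant overwrites every listed coordinate of `z`, so `x` and `z` need to agree only on the
others. With all coordinates listed, the bound is uniform in `x`. -/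
lemma enorm_samplingError_le_majorant (hg : ContinuousOn g (Icc 0 1)) (l : List (Fin d))
    (hk : ContDiffOn ℝ (⊤ : ℕ∞) k (Icc (-1) 1)) {x z : Fin d → ℝ} (hx : x ∈ unitCube d)
    (hxz : ∀ i ∉ l, x i = z i) (y : Fin n → Fin d → ℝ) :
    ‖samplingError (clampedIntegrand mul g k) y x‖ₑ ≤ majorant mul g l k y z := by
  induction l generalizing k x z with
  | nil =>
    have : x = z := funext fun i => hxz i (by simp)
    rw [this, majorant]
  | cons j l ih =>
    have hupd : ∀ s : ℝ, ∀ i ∉ l, Function.update x j s i = Function.update z j s i := by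
      intro s i hi
      by_cases h : i = j
      · subst h; simp
      · simp only [Function.update_of_ne h]
        exact hxz i (by simp [h, hi])
    have hx1 : x j ≤ 1 := hx.2 j
    rw [samplingError_clampedIntegrand_eq hg hk hx j, majorant]
    refine (enorm_add_le _ _).trans (add_le_add ?_ ?_)
    · exact ih hk (update_mem_unitCube hx j ⟨le_rfl, zero_le_one⟩) (hupd 0)
    · refine (enorm_integral_le_lintegral_enorm _).trans ?_
      -- Enlarging the range from `[0, x j]` to `[0,1]` is what removes `x j` from the bound.
      refine (lintegral_mono_set (Icc_subset_Icc_right hx1)).trans ?_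
      refine setLIntegral_mono' measurableSet_Icc fun s hs => ?_
      exact ih (contDiffOn_partialDeriv hk j) (update_mem_unitCube hx j hs) (hupd s)

end Kernel

section ENNRealInequalities

/-- The sum is at most twice the larger term; the crude constant `4` is enough here. -/
lemma ennreal_add_sq_le (a b : ℝ≥0∞) : (a + b) ^ 2 ≤ 4 * a ^ 2 + 4 * b ^ 2 := by
  have h : ∀ c : ℝ≥0∞, (c + c) ^ 2 = 4 * c ^ 2 := fun c => by
    rw [← two_mul, mul_pow]; norm_num
  rcases le_total a b with hab | hab
  · exact (pow_le_pow_left₀ (zero_le) (add_le_add_left hab b) 2).trans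
      ((h b).le.trans le_add_self)
  · exact (pow_le_pow_left₀ (zero_le) (add_le_add_right hab a) 2).trans
      ((h a).le.trans le_self_add)

lemma lintegral_sq_le_lintegral_sq {α : Type*} [MeasurableSpace α] {μ : Measure α}
    [IsProbabilityMeasure μ] {f : α → ℝ≥0∞} (hf : AEMeasurable f μ) :
    (∫⁻ x, f x ∂μ) ^ 2 ≤ ∫⁻ x, f x ^ 2 ∂μ := by
  have h := ENNReal.lintegral_mul_le_Lp_mul_Lq μ Real.HolderConjugate.two_two hf
    (aemeasurable_const (b := (1 : ℝ≥0∞)))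
  simp only [Pi.mul_apply, mul_one, ENNReal.rpow_two, one_pow, lintegral_const, measure_univ,
    ENNReal.one_rpow] at h
  refine (pow_le_pow_left₀ (zero_le) h 2).trans (le_of_eq ?_)
  rw [← ENNReal.rpow_two, ← ENNReal.rpow_mul]
  norm_num

end ENNRealInequalities

/-! ### Second moment of the majorant. -/

section MajorantBound

universe u

variable {d b t : ℕ} [NeZero b] {A : Type*} [NormedAddCommGroup A] [InnerProductSpace ℝ A]
  [FiniteDimensional ℝ A] {mul : A →ₗ[ℝ] A →ₗ[ℝ] A} {g k : (Fin d → ℝ) → A}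

/-- The points are limits of functions of finitely many permutations. Tonelli's theorem for the
majorant needs this measurability. -/
lemma IsScrambledNet.measurable (hb : 2 ≤ b) {m : ℕ} {Ω : Type*} [MeasurableSpace Ω]
    {P : Measure Ω} {Y : Fin (b ^ m) → Ω → Fin d → ℝ} (hY : IsScrambledNet b t m P Y) :
    Measurable fun ω i => Y i ω := by
  obtain ⟨a, π, -, hπ, hYa⟩ := hY
  refine measurable_pi_lambda _ fun i => measurable_pi_lambda _ fun j => ?_
  refine measurable_of_tendsto_metrizable
    (f := fun K ω => gridPoint (scrambleTable (truncatedPerms K π ω) (digitTable b K (a i))) j)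
    (fun K => ?_) ?_
  · let M : MeasurableSpace (Node b d K → Equiv.Perm (Fin b)) := ⊤
    have hR : Measurable (truncatedPerms K π) :=
      measurable_to_countable' fun p => hπ.measurableSet_truncatedPerms p
    have hF : Measurable fun p : Node b d K → Equiv.Perm (Fin b) =>
      gridPoint (scrambleTable p (digitTable b K (a i))) j := fun _ _ => trivial
    exact hF.comp hR
  · refine tendsto_pi_nhds.2 fun ω => ?_
    refine tendsto_iff_dist_tendsto_zero.2 (squeeze_zero (fun _ => dist_nonneg) (fun K => ?_)
      (tendsto_inv_pow_atTop hb))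
    rw [dist_comm, Real.dist_eq, hYa]
    exact abs_scramble_sub_gridPoint_le K ω (a i) j

lemma exists_norm_clampedIntegrand_le (hg : ContinuousOn g (Icc 0 1))
    (hk : ContinuousOn k (Icc (-1) 1)) :
    ∃ B : ℝ≥0, ∀ x y, ‖clampedIntegrand mul g k x y‖ₑ ≤ B := by
  obtain ⟨B, hB⟩ := ((isCompact_unitCube (d := d)).prod
    (isCompact_unitCube (d := d))).exists_bound_of_continuousOn
    (continuous_clampedIntegrand (mul := mul) hg hk).continuousOn
  refine ⟨B.toNNReal, fun x y => ?_⟩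
  have h := hB (clamp x, clamp y) ⟨clamp_mem x, clamp_mem y⟩
  simp only [Function.uncurry, clampedIntegrand, clamp_of_mem (clamp_mem _)] at h
  rw [← ofReal_norm]
  exact ENNReal.ofReal_le_ofReal h

lemma enorm_sub_setIntegral_unitCube_le {φ : (Fin d → ℝ) → A} {B : ℝ≥0} (hB : ∀ y, ‖φ y‖ₑ ≤ B)
    (y : Fin d → ℝ) : ‖φ y - ∫ v in unitCube d, φ v‖ₑ ≤ 2 * B := by
  refine enorm_sub_le.trans ?_
  rw [two_mul]
  refine add_le_add (hB y) ((enorm_integral_le_lintegral_enorm _).trans ?_)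
  refine (lintegral_mono hB).trans ?_
  simp [volume_unitCube]

/-- The constant is uniform in `z`, so the induction hypothesis for `∂_j k` can be integrated over
the position `s`. The base case is the pointwise bound with the variance replaced by a uniform bound
on the integrand. -/
lemma exists_lintegral_majorant_sq_le (hb : 2 ≤ b) (hg : ContinuousOn g (Icc 0 1))
    (l : List (Fin d)) (hk : ContDiffOn ℝ (⊤ : ℕ∞) k (Icc (-1) 1)) :
    ∃ C : ℝ≥0, ∀ (m : ℕ) (Ω : Type u) [MeasurableSpace Ω] (P : Measure Ω)
      [IsProbabilityMeasure P] (Y : Fin (b ^ m) → Ω → Fin d → ℝ), IsScrambledNet b t m P Y →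
      ∀ z, ∫⁻ ω, majorant mul g l k (fun i => Y i ω) z ^ 2 ∂P ≤ C / ((b ^ m : ℕ) : ℝ≥0∞) := by
  induction l generalizing k with
  | nil =>
    obtain ⟨B, hB⟩ := exists_norm_clampedIntegrand_le (mul := mul) hg hk.continuousOn
    refine ⟨((b ^ (t + d) : ℕ) : ℝ≥0) * (2 * B) ^ 2, fun m Ω _ P _ Y hY z => ?_⟩
    have hcont : Continuous (clampedIntegrand mul g k z) :=
      (continuous_clampedIntegrand hg hk.continuousOn).comp (continuous_const.prodMk continuous_id)
    refine (lintegral_enorm_sub_integral_sq_le hb hY hcont).trans ?_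
    rw [ENNReal.coe_mul]
    gcongr
    refine (lintegral_mono fun y =>
      pow_le_pow_left₀ (zero_le) (enorm_sub_setIntegral_unitCube_le (hB z) y) 2).trans ?_
    simp [volume_unitCube]
  | cons j l ih =>
    obtain ⟨C₁, hC₁⟩ := ih hk
    obtain ⟨C₂, hC₂⟩ := ih (contDiffOn_partialDeriv hk j)
    refine ⟨4 * C₁ + 4 * C₂, fun m Ω _ P _ Y hY z => ?_⟩
    have hYm := hY.measurable hb
    have hprob : IsProbabilityMeasure (volume.restrict (Icc (0 : ℝ) 1)) := ⟨by simp⟩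
    have h1 : Measurable fun ω => majorant mul g l k (fun i => Y i ω) (Function.update z j 0) :=
      (measurable_majorant hg l hk).comp (hYm.prodMk measurable_const)
    have h2 : Measurable fun q : Ω × ℝ =>
        majorant mul g l (partialDeriv j k) (fun i => Y i q.1) (Function.update z j q.2) := by
      have hu : Continuous fun s : ℝ => Function.update z j s := by fun_prop
      exact (measurable_majorant hg l (contDiffOn_partialDeriv hk j)).comp
        ((hYm.comp measurable_fst).prodMk (hu.measurable.comp measurable_snd))
    have hpt : ∀ ω, majorant mul g (j :: l) k (fun i => Y i ω) z ^ 2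
        ≤ 4 * majorant mul g l k (fun i => Y i ω) (Function.update z j 0) ^ 2
          + 4 * ∫⁻ s in Icc (0 : ℝ) 1, majorant mul g l (partialDeriv j k) (fun i => Y i ω)
            (Function.update z j s) ^ 2 := by
      intro ω
      rw [majorant]
      refine (ennreal_add_sq_le _ _).trans ?_
      gcongr
      exact lintegral_sq_le_lintegral_sq (h2.comp measurable_prodMk_left).aemeasurable
    refine (lintegral_mono hpt).trans ?_
    rw [lintegral_add_left ((h1.pow_const 2).const_mul 4), lintegral_const_mul _ (h1.pow_const 2),
      lintegral_const_mul _ (h2.pow_const 2).lintegral_prod_right',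
      lintegral_lintegral_swap (h2.pow_const 2).aemeasurable]
    rw [ENNReal.coe_add, ENNReal.coe_mul, ENNReal.coe_mul, ENNReal.coe_ofNat, ENNReal.add_div, mul_div_assoc, mul_div_assoc]
    gcongr
    · exact hC₁ m Ω P Y hY _
    · refine (lintegral_mono fun s => hC₂ m Ω P Y hY _).trans ?_
      rw [lintegral_const, measure_univ, mul_one]

end MajorantBound

/-! ### The bounds for the estimator. -/

section Bounds

universe u

variable {d b t : ℕ} [NeZero b] {A : Type*} [NormedAddCommGroup A] [InnerProductSpace ℝ A]
  [FiniteDimensional ℝ A] {mul : A →ₗ[ℝ] A →ₗ[ℝ] A} {g k : (Fin d → ℝ) → A}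

lemma clampedIntegrand_of_mem {x y : Fin d → ℝ} (hx : x ∈ unitCube d) (hy : y ∈ unitCube d) :
    clampedIntegrand mul g k x y = integrand mul g k x y := by
  rw [clampedIntegrand, clamp_of_mem hx, clamp_of_mem hy]

lemma target_eq {x : Fin d → ℝ} (hx : x ∈ unitCube d) :
    target mul g k x = ∫ y in unitCube d, clampedIntegrand mul g k x y :=
  setIntegral_congr_fun measurableSet_Icc fun _ hy => (clampedIntegrand_of_mem hx hy).symm

lemma estimator_sub_target_eq {n : ℕ} {x : Fin d → ℝ} (hx : x ∈ unitCube d)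
    {y : Fin n → Fin d → ℝ} (hy : ∀ i, y i ∈ unitCube d) :
    estimator mul g k y x - target mul g k x
      = samplingError (clampedIntegrand mul g k) y x := by
  rw [target_eq hx, estimator, samplingError]
  simp only [clampedIntegrand_of_mem hx (hy _)]

lemma mse_le (hb : 2 ≤ b) (hg : ContinuousOn g (Icc 0 1)) (hk : ContinuousOn k (Icc (-1) 1))
    {m : ℕ} {Ω : Type*} [MeasurableSpace Ω] {P : Measure Ω} [IsProbabilityMeasure P]
    {Y : Fin (b ^ m) → Ω → Fin d → ℝ} (hY : IsScrambledNet b t m P Y) {x : Fin d → ℝ}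
    (hx : x ∈ unitCube d) :
    mse mul g k P Y x ≤ ((b ^ (t + d) : ℕ) : ℝ≥0) * variance mul g k x / ((b ^ m : ℕ) : ℝ≥0∞) := by
  have hcont : Continuous (clampedIntegrand mul g k x) :=
    (continuous_clampedIntegrand hg hk).comp (continuous_const.prodMk continuous_id)
  have h := lintegral_enorm_sub_integral_sq_le hb hY hcont
  have hvar : variance mul g k x = ∫⁻ y in unitCube d, ‖clampedIntegrand mul g k x y
      - ∫ v in unitCube d, clampedIntegrand mul g k x v‖ₑ ^ 2 := by
    rw [variance, target_eq hx]
    exact setLIntegral_congr_fun measurableSet_Icc fun y hy => by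
      rw [clampedIntegrand_of_mem hx hy]
  have hmse : mse mul g k P Y x
      = ∫⁻ ω, ‖samplingError (clampedIntegrand mul g k) (fun i => Y i ω) x‖ₑ ^ 2 ∂P :=
    lintegral_congr fun ω => by rw [estimator_sub_target_eq hx fun i => hY.mem_unitCube i ω]
  rw [hmse, hvar]
  exact h

lemma supVariance_lt_top (hg : ContinuousOn g (Icc 0 1)) (hk : ContinuousOn k (Icc (-1) 1)) :
    supVariance mul g k < ⊤ := by
  obtain ⟨B, hB⟩ := exists_norm_clampedIntegrand_le (mul := mul) hg hk
  have h : ∀ y ∈ unitCube d, (⨆ x ∈ unitCube d, ‖integrand mul g k x y - target mul g k x‖ₑ) ^ 2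
      ≤ ((2 * B : ℝ≥0∞)) ^ 2 := by
    intro y hy
    refine pow_le_pow_left₀ (zero_le) (iSup₂_le fun x hx => ?_) 2
    rw [← clampedIntegrand_of_mem hx hy, target_eq hx]
    exact enorm_sub_setIntegral_unitCube_le (hB x) y
  refine (setLIntegral_mono' measurableSet_Icc h).trans_lt ?_
  rw [setLIntegral_const]
  have : volume (Icc (0 : Fin d → ℝ) 1) = 1 := volume_unitCube
  rw [this, mul_one, ← ENNReal.coe_ofNat, ← ENNReal.coe_mul, ← ENNReal.coe_pow]
  exact ENNReal.coe_lt_top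

lemma unitCube_subset_closure_interior : unitCube d ⊆ closure (interior (unitCube d)) := by
  have hne : (interior (unitCube d)).Nonempty := by
    rw [unitCube, ← Set.pi_univ_Icc, interior_pi_set finite_univ]
    refine Set.univ_pi_nonempty_iff.2 fun j => ?_
    rw [Pi.zero_apply, Pi.one_apply, interior_Icc]
    exact nonempty_Ioo.2 one_pos
  have hconv : Convex ℝ (unitCube d) := convex_Icc 0 1
  rw [hconv.closure_interior_eq_closure_of_nonempty_interior hne]
  exact subset_closure

/-- Zero variance gives equality almost everywhere in `y`. Continuity extends it to the whole cube,
boundary included, where scrambled points may lie. -/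
lemma integrand_eq_target_of_supVariance_eq_zero (hg : ContinuousOn g (Icc 0 1))
    (hk : ContinuousOn k (Icc (-1) 1)) (h0 : supVariance mul g k = 0) {x y : Fin d → ℝ}
    (hx : x ∈ unitCube d) (hy : y ∈ unitCube d) : integrand mul g k x y = target mul g k x := by
  have hcont : Continuous (clampedIntegrand mul g k x) :=
    (continuous_clampedIntegrand hg hk).comp (continuous_const.prodMk continuous_id)
  have hle : ∫⁻ v in unitCube d, ‖clampedIntegrand mul g k x v - target mul g k x‖ₑ ^ 2 ≤ 0 := by
    rw [← h0]
    refine setLIntegral_mono' measurableSet_Icc fun v hv => pow_le_pow_left₀ (zero_le) ?_ 2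
    rw [clampedIntegrand_of_mem hx hv]
    exact le_iSup₂ (f := fun x (_ : x ∈ unitCube d) =>
      ‖integrand mul g k x v - target mul g k x‖ₑ) x hx
  have hm : Measurable fun v => ‖clampedIntegrand mul g k x v - target mul g k x‖ₑ ^ 2 :=
    ((hcont.sub continuous_const).enorm.measurable).pow_const 2
  have hae := (lintegral_eq_zero_iff hm).1 (le_antisymm hle (zero_le))
  have hae' : clampedIntegrand mul g k x =ᵐ[volume.restrict (unitCube d)]
      fun _ => target mul g k x := by
    filter_upwards [hae] with v hv
    simpa [sub_eq_zero] using hv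
  rw [← clampedIntegrand_of_mem hx hy]
  exact Measure.eqOn_of_ae_eq hae' hcont.continuousOn continuousOn_const
    unitCube_subset_closure_interior hy

lemma exists_supMse_le (hb : 2 ≤ b) (hg : ContinuousOn g (Icc 0 1))
    (hk : ContDiffOn ℝ (⊤ : ℕ∞) k (Icc (-1) 1)) :
    ∃ Γ' : ℝ≥0, ∀ (m : ℕ) (Ω : Type u) [MeasurableSpace Ω] (P : Measure Ω)
      [IsProbabilityMeasure P] (Y : Fin (b ^ m) → Ω → Fin d → ℝ), IsScrambledNet b t m P Y →
      supMse mul g k P Y ≤ Γ' * supVariance mul g k / ((b ^ m : ℕ) : ℝ≥0∞) := by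
  -- Division by `σ²(h)` is impossible if it vanishes, but then the integrand is constant in `y` and
  -- the estimator is exact.
  by_cases h0 : supVariance mul g k = 0
  · refine ⟨0, fun m Ω _ P _ Y hY => ?_⟩
    have hn : (b ^ m : ℕ) ≠ 0 := pow_ne_zero _ (NeZero.ne b)
    have hz : ∀ ω, ∀ x ∈ unitCube d,
        ‖estimator mul g k (fun i => Y i ω) x - target mul g k x‖ₑ = 0 := by
      intro ω x hx
      have : ∀ i, integrand mul g k x (Y i ω) = target mul g k x := fun i =>
        integrand_eq_target_of_supVariance_eq_zero hg hk.continuousOn h0 hx (hY.mem_unitCube i ω)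
      rw [estimator]
      simp only [this, Finset.sum_const, Finset.card_univ, Fintype.card_fin]
      rw [← Nat.cast_smul_eq_nsmul ℝ, inv_smul_smul₀ (Nat.cast_ne_zero.2 hn), sub_self, enorm_zero]
    have hsup : ∀ ω, (⨆ x ∈ unitCube d,
        ‖estimator mul g k (fun i => Y i ω) x - target mul g k x‖ₑ) = 0 := fun ω =>
      le_antisymm (iSup₂_le fun x hx => (hz ω x hx).le) (zero_le)
    simp [supMse, hsup]
  · obtain ⟨C, hC⟩ := exists_lintegral_majorant_sq_le.{u} (t := t) (mul := mul) hb hg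
      (Finset.univ : Finset (Fin d)).toList hk
    have htop := (supVariance_lt_top (mul := mul) hg hk.continuousOn).ne
    -- `Γ'` may depend on `g` and `k`, so the factor `σ²(h)` is produced by dividing the constant
    -- `C` by it.
    refine ⟨C / (supVariance mul g k).toNNReal, fun m Ω _ P _ Y hY => ?_⟩
    have hcancel : ((C / (supVariance mul g k).toNNReal : ℝ≥0) : ℝ≥0∞) * supVariance mul g k
        = C := by
      rw [ENNReal.coe_div (by simp [ENNReal.toNNReal_eq_zero_iff, h0, htop]),
        ENNReal.coe_toNNReal htop, ENNReal.div_mul_cancel h0 htop]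
    rw [hcancel]
    refine le_trans (lintegral_mono fun ω => ?_) (hC m Ω P Y hY 0)
    refine pow_le_pow_left₀ (zero_le) (iSup₂_le fun x hx => ?_) 2
    rw [estimator_sub_target_eq hx fun i => hY.mem_unitCube i ω]
    exact enorm_samplingError_le_majorant hg _ hk hx (by simp) _

end Bounds

end ScrambledNet

end

theorem mainTheorem2 (d b t : ℕ) [NeZero b] (hb : 2 ≤ b) :
    -- a constant that depends on `t`, `d` and `b` only
    ∃ Γ : ℝ≥0, ∀ (A : Type*) [NormedAddCommGroup A] [InnerProductSpace ℝ A]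
      [FiniteDimensional ℝ A] (mul : A →ₗ[ℝ] A →ₗ[ℝ] A) (g k : (Fin d → ℝ) → A),
      ContDiffOn ℝ (⊤ : ℕ∞) g (Icc 0 1) → ContDiffOn ℝ (⊤ : ℕ∞) k (Icc (-1) 1) →
      ∀ ε : ℝ, 0 < ε →
      (∀ x ∈ ScrambledNet.unitCube d,
        MemLp (ScrambledNet.integrand mul g k x) (ENNReal.ofReal (1 + ε))
          (volume.restrict (ScrambledNet.unitCube d))) →
      -- the variance bound at each point, and for the maximum over the points
      (∀ (m : ℕ) (Ω : Type*) [MeasurableSpace Ω] (P : Measure Ω) [IsProbabilityMeasure P]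
        (Y : Fin (b ^ m) → Ω → Fin d → ℝ), ScrambledNet.IsScrambledNet b t m P Y →
        (∀ x ∈ ScrambledNet.unitCube d,
          ScrambledNet.mse mul g k P Y x ≤
            Γ * ScrambledNet.variance mul g k x / ((b ^ m : ℕ) : ℝ≥0∞)) ∧
        (⨆ x ∈ ScrambledNet.unitCube d, ScrambledNet.mse mul g k P Y x) ≤
          Γ * (⨆ x ∈ ScrambledNet.unitCube d, ScrambledNet.variance mul g k x) /
            ((b ^ m : ℕ) : ℝ≥0∞)) ∧
      -- the sup-norm bound, with a constant that does not depend on the number of points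
      ScrambledNet.supVariance mul g k < ⊤ ∧
      (∃ Γ' : ℝ≥0, ∀ (m : ℕ) (Ω : Type*) [MeasurableSpace Ω] (P : Measure Ω)
        [IsProbabilityMeasure P] (Y : Fin (b ^ m) → Ω → Fin d → ℝ),
        ScrambledNet.IsScrambledNet b t m P Y →
        ScrambledNet.supMse mul g k P Y ≤
          Γ' * ScrambledNet.supVariance mul g k / ((b ^ m : ℕ) : ℝ≥0∞)) ∧
      -- the rate `O(1/n)`
      (∀ (Ω : ℕ → Type*) [∀ m, MeasurableSpace (Ω m)] (P : ∀ m, Measure (Ω m))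
        [∀ m, IsProbabilityMeasure (P m)] (Y : ∀ m, Fin (b ^ m) → Ω m → Fin d → ℝ),
        (∀ m, t ≤ m → ScrambledNet.IsScrambledNet b t m (P m) (Y m)) →
        (fun m => (ScrambledNet.supMse mul g k (P m) (Y m)).toReal) =O[atTop]
          fun m => ((b ^ m : ℕ) : ℝ)⁻¹) := by
  refine ⟨((b ^ (t + d) : ℕ) : ℝ≥0), fun A _ _ _ mul g k hg hk ε _ _ => ?_⟩
  have hg' := hg.continuousOn
  have hk' := hk.continuousOn
  have htop := ScrambledNet.supVariance_lt_top (mul := mul) hg' hk'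
  refine ⟨fun m Ω _ P _ Y hY => ?_, htop, ScrambledNet.exists_supMse_le hb hg' hk, ?_⟩
  · have hmse := fun x (hx : x ∈ ScrambledNet.unitCube d) =>
      ScrambledNet.mse_le (mul := mul) hb hg' hk' hY hx
    refine ⟨hmse, iSup₂_le fun x hx => (hmse x hx).trans ?_⟩
    gcongr
    exact le_iSup₂ (f := fun x (_ : x ∈ ScrambledNet.unitCube d) =>
      ScrambledNet.variance mul g k x) x hx
  · intro Ω _ P _ Y hY
    obtain ⟨Γ', hΓ'⟩ := ScrambledNet.exists_supMse_le (t := t) (mul := mul) hb hg' hk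
    -- The constant is `Γ' σ²(h)`, whose finiteness keeps `toReal` monotone in the comparison below.
    refine IsBigO.of_bound (Γ' * ScrambledNet.supVariance mul g k).toReal ?_
    filter_upwards [eventually_ge_atTop t] with m hm
    have hn : ((b ^ m : ℕ) : ℝ≥0∞) ≠ 0 := Nat.cast_ne_zero.2 (pow_ne_zero _ (NeZero.ne b))
    have hfin : Γ' * ScrambledNet.supVariance mul g k ≠ ⊤ :=
      ENNReal.mul_ne_top ENNReal.coe_ne_top htop.ne
    have h := ENNReal.toReal_mono (ENNReal.div_ne_top hfin hn) (hΓ' m (Ω m) (P m) (Y m) (hY m hm))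
    rw [Real.norm_of_nonneg ENNReal.toReal_nonneg, norm_inv, Real.norm_natCast,
      ← div_eq_mul_inv]
    rwa [ENNReal.toReal_div, ENNReal.toReal_natCast] at h
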